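/- **Forks.** Let $w\in\{0,1\}^n$. A *fork* $F\vdash w$ is a finite rooted tree, edges directed away from the root, with a labelling $\ell$ of its vertices by $\{0,\dots,n\}$ such that the root has label $0$; labels strictly increase along directed paths; each index $i$ with $w_i=0$ labels exactly one vertex; and if $w_i=w_j=0$ and $i<j$, then the vertex labelled $i$ has strictly smaller depth than the vertex labelled $j$. A vertex is *honest* if $w_{\ell(v)}=0$ (in particular $\ell(v)\ge 1$). A *tine* is a directed path starting at the root (possibly of length $0$); its *length* is its number of edges, and $\mathrm{height}(F)$ is the maximum length of a tine. $F$ is *closed* if every leaf is honest or $F$ consists of the root only. For a tine $t$ with last vertex $v$ of a closed fork let $$\mathrm{reach}(t)=\#\{i : w_i=1,\ i>\ell(v)\}-\bigl(\mathrm{height}(F)-\mathrm{length}(t)\bigr).$$ For $w=xy$ and tines $t_1,t_2$ (not necessarily different) write $t_1\not\sim_x t_2$ if they share no edge that ends at a vertex with label greater than $|x|$. Define the relative margin $$\mu_x(y)=\max_{F\vdash xy,\ F\text{ closed}}\ \max_{t_1\not\sim_x t_2}\ \min\{\mathrm{reach}(t_1),\mathrm{reach}(t_2)\}.$$ A fork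 $F\vdash xy$ (closed or not) is *$x$-balanced* if it has tines $t_1\not\sim_x t_2$ with $\mathrm{length}(t_1)=\mathrm{length}(t_2)=\mathrm{height}(F)$. **Distributions.** A random string $W=(W_1,\dots,W_n)\in\{0,1\}^n$ satisfies the *$\epsilon$-martingale condition* if for every $t\in\{1,\dots,n\}$, $\Pr[W_t=1\mid W_1,\dots,W_{t-1}]\le(1-\epsilon)/2$, i.e. for every history of positive probability. $\mathcal B_\epsilon$ is the distribution of a string of independent bits, each equal to $1$ with probability $(1-\epsilon)/2$. **Theorem.** 1. There is an absolute constant $C>0$ such that the following holds for all $\epsilon\in(0,1)$ and all integers $m,k\ge 0$. Let $x\in\{0,1\}^m$ and $y\in\{0,1\}^k$ be random strings such that the concatenation $xy=(x_1,\dots,x_m,y_1,\dots,y_k)$ satisfies the $\epsilon$-martingale condition, and let $x'\in\{0,1\}^m$ and $y'\in\{0,1\}^k$ be independent random strings, each distributed according to $\mathcal B_\epsilon$. Then $$\Pr[\mu_x(y)\ge 0]\ \le\ \Pr[\mu_{x'}(y')\ge 0]\ \le\ \exp\bigl(-\epsilon^3(1-C\epsilon)\,k/2\bigr).$$ 2.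 For every $\epsilon\in(0,1)$ there is a constant $c>0$, depending only on $\epsilon$, such that for all integers $m,k\ge0$ and all random strings $x\in\{0,1\}^m$, $y\in\{0,1\}^k$ for which $xy$ satisfies the $\epsilon$-martingale condition, $$\Pr[\text{there is an }x\text{-balanced fork for }xy]\ =\ \Pr[\mu_x(y)\ge 0]\ \le\ \exp(-c\,k).$$ In particular the bound does not depend on $|x|=m$. -/

import Mathlib

open MeasureTheory ProbabilityTheory

/-- A finite rooted tree whose vertices are labelled by slots `0, …, n`. It is given by its parent
map: the directed edges are the pairs `(parent v, v)` with `v ≠ root`. The root has label `0` and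
labels strictly increase along edges (hence along directed paths), so that iterating `parent` from
any vertex ends at the root. A directed path from the root (a tine) is determined by the vertex at
which it terminates, so tines are identified with vertices. -/
structure SlotTree (n : ℕ) where
  V : Type
  [fintypeV : Fintype V]
  root : V
  parent : V → V
  parent_root : parent root = root
  label : V → ℕ
  label_le : ∀ v, label v ≤ n
  label_root : label root = 0
  label_parent_lt : ∀ v, v ≠ root → label (parent v) < label v

namespace SlotTree

variable {n : ℕ} (F : SlotTree n)

instance : Fintype F.V := F.fintypeV

/-- Depth of a vertex = length (number of edges) of the tine terminating there. -/
noncomputable def depth (v : F.V) : ℕ := sInf {j : ℕ | F.parent^[j] v = F.root}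

/-- The length of the longest tine. -/
noncomputable def height : ℕ := Finset.univ.sup F.depth

/-- The vertex `u` lies on the tine terminating at `v`. -/
def OnTine (u v : F.V) : Prop := ∃ j : ℕ, F.parent^[j] v = u

/-- `t₁ ∼ₓ t₂` for `|x| = m`: the tines share an edge that terminates at a vertex whose label is
larger than `m`, i.e. an index of `y`. (The edge terminating at `u ≠ root` is `(parent u, u)`, and
it lies on a tine iff `u` does; `m < label u` forces `u ≠ root`.) -/
def ShareEdgeAfter (m : ℕ) (t₁ t₂ : F.V) : Prop :=
  ∃ u : F.V, m < F.label u ∧ F.OnTine u t₁ ∧ F.OnTine u t₂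

def IsLeaf (v : F.V) : Prop := ∀ u : F.V, u ≠ F.root → F.parent u ≠ v

/-- A vertex is honest for `w` if its label is an index (counted from `1`) with `w = 0` there. -/
def IsHonest (w : Fin n → Bool) (v : F.V) : Prop :=
  ∃ i : Fin n, w i = false ∧ F.label v = (i : ℕ) + 1

end SlotTree

/-- Forks for the characteristic string `w`, where `false` is `0` (honest) and `true` is `1`
(adversarial), and the position `i : Fin n` is the slot `i + 1`. -/
structure Fork {n : ℕ} (w : Fin n → Bool) extends SlotTree n where
  existsUnique_honest : ∀ i : Fin n, w i = false → ∃! v : V, label v = (i : ℕ) + 1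
  honest_depth_lt : ∀ u v : V, toSlotTree.IsHonest w u → toSlotTree.IsHonest w v →
    label u < label v → toSlotTree.depth u < toSlotTree.depth v

namespace Fork

variable {n : ℕ} {w : Fin n → Bool} (F : Fork w)

/-- Every leaf is honest, or the fork is trivial (consists of the root alone). -/
def Closed : Prop :=
  (∀ v : F.V, F.IsLeaf v → F.IsHonest w v) ∨ (∀ v : F.V, v = F.root)

/-- For `w = xy` with `|x| = m`: the fork is `x`-balanced. -/
def Balanced (m : ℕ) : Prop :=
  ∃ t₁ t₂ : F.V, ¬ F.ShareEdgeAfter m t₁ t₂ ∧ F.depth t₁ = F.height ∧ F.depth t₂ = F.height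

/-- Length of a longest tine minus the length of `t`. -/
noncomputable def gap (t : F.V) : ℤ := (F.height : ℤ) - (F.depth t : ℤ)

/-- Number of adversarial slots after the label of the last vertex of `t`. -/
def reserve (t : F.V) : ℕ :=
  (Finset.univ.filter fun i : Fin n => w i = true ∧ F.label t < (i : ℕ) + 1).card

noncomputable def reach (t : F.V) : ℤ := (F.reserve t : ℤ) - F.gap t

/-- The values over which the maximum defining the relative margin of a fork is taken. -/
def marginValues (m : ℕ) : Set ℤ :=
  {z | ∃ t₁ t₂ : F.V, ¬ F.ShareEdgeAfter m t₁ t₂ ∧ z = min (F.reach t₁) (F.reach t₂)}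

/-- `μₓ(F)`, for `w = xy` with `|x| = m`. -/
noncomputable def margin (m : ℕ) : ℤ := sSup (F.marginValues m)

end Fork

/-- The values over which the maximum defining `μₓ(y)` is taken. -/
def relMarginValues {m k : ℕ} (x : Fin m → Bool) (y : Fin k → Bool) : Set ℤ :=
  {z | ∃ F : Fork (Fin.append x y), F.Closed ∧ z = F.margin m}

/-- The relative margin `μₓ(y)`: the maximum of `μₓ(F)` over all closed forks `F` for `xy`. -/
noncomputable def relMargin {m k : ℕ} (x : Fin m → Bool) (y : Fin k → Bool) : ℤ :=
  sSup (relMarginValues x y)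

/-- There is an `x`-balanced fork for `xy`. -/
def HasBalancedFork {m k : ℕ} (x : Fin m → Bool) (y : Fin k → Bool) : Prop :=
  ∃ F : Fork (Fin.append x y), F.Balanced m

/-- The `ε`-martingale condition: `W` is a random string and, for every `t` and every history `u`,
`Pr[W_t = 1 ∣ W_i = u_i for all i < t] ≤ (1 - ε) / 2`. (Conditioning on a null event gives the zero
measure in Mathlib, so nothing is asked about histories of probability zero.) -/
def EpsMartingale {Ω : Type*} [MeasurableSpace Ω] (P : Measure Ω) (ε : ℝ) {n : ℕ}
    (W : Ω → Fin n → Bool) : Prop :=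
  Measurable W ∧ ∀ (t : Fin n) (u : Fin n → Bool),
    (P[|{ω | ∀ i, i < t → W ω i = u i}]).real {ω | W ω t = true} ≤ (1 - ε) / 2

/-- `B` has distribution `𝓑_ε`: independent bits with `Pr[B_i = 1] = (1 - ε) / 2`. -/
def IsBernoulliString {Ω : Type*} [MeasurableSpace Ω] (P : Measure Ω) (ε : ℝ) {n : ℕ}
    (B : Ω → Fin n → Bool) : Prop :=
  Measurable B ∧ iIndepFun (fun i ω => B ω i) P ∧
    ∀ i, P.real {ω | B ω i = true} = (1 - ε) / 2

/-! The maxima above are attained, so that the suprema carry no default value. -/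

namespace Fork

variable {n : ℕ} {w : Fin n → Bool} (F : Fork w)

theorem reach_le (t : F.V) : F.reach t ≤ n := by
  have h1 : F.reserve t ≤ n := (Finset.card_filter_le _ _).trans (by simp)
  have h2 : F.depth t ≤ F.height := Finset.le_sup (Finset.mem_univ t)
  unfold reach gap
  omega

theorem iterate_root (j : ℕ) : F.parent^[j] F.root = F.root :=
  Function.iterate_fixed F.parent_root j

theorem root_not_shareEdgeAfter (m : ℕ) : ¬ F.ShareEdgeAfter m F.root F.root := by
  rintro ⟨u, hu, ⟨j, hj⟩, -⟩
  rw [iterate_root] at hj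
  subst hj
  rw [F.label_root] at hu
  omega

theorem marginValues_le (m : ℕ) {z : ℤ} (hz : z ∈ F.marginValues m) : z ≤ n := by
  obtain ⟨t₁, t₂, -, rfl⟩ := hz
  exact (min_le_left _ _).trans (F.reach_le t₁)

theorem margin_isGreatest (m : ℕ) : IsGreatest (F.marginValues m) (F.margin m) := by
  have hne : (F.marginValues m).Nonempty :=
    ⟨_, F.root, F.root, F.root_not_shareEdgeAfter m, rfl⟩
  have hb : BddAbove (F.marginValues m) := ⟨n, fun z hz => F.marginValues_le m hz⟩
  exact ⟨Int.csSup_mem hne hb, fun z hz => le_csSup hb hz⟩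

end Fork

/-- The tree that is a single path `0 → 1 → … → h` with increasing labels. -/
def SlotTree.path {n h : ℕ} (l : Fin h → Fin n) (hl : StrictMono l) : SlotTree n where
  V := Fin (h + 1)
  root := 0
  parent := fun v => ⟨(v : ℕ) - 1, by omega⟩
  parent_root := rfl
  label := Fin.cases 0 (fun j => (l j : ℕ) + 1)
  label_le := fun v => by
    refine Fin.cases ?_ (fun j => ?_) v
    · simp
    · simp
  label_root := rfl
  label_parent_lt := fun v hv => by
    obtain ⟨j, rfl⟩ := Fin.exists_succ_eq.2 hv
    obtain ⟨j, hj⟩ := j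
    cases j with
    | zero => simp
    | succ j =>
      have h1 : l ⟨j, by omega⟩ < l ⟨j + 1, hj⟩ := hl (by simp)
      have h2 : (⟨((Fin.succ ⟨j + 1, hj⟩ : Fin (h + 1)) : ℕ) - 1, by omega⟩ : Fin (h + 1))
          = Fin.succ ⟨j, by omega⟩ := by ext; simp
      simp only [h2, Fin.cases_succ]
      exact Nat.succ_lt_succ h1

theorem SlotTree.path_iterate {n h : ℕ} (l : Fin h → Fin n) (hl : StrictMono l)
    (j : ℕ) (v : Fin (h + 1)) :
    Fin.val (n := h + 1) ((SlotTree.path l hl).parent^[j] v) = (v : ℕ) - j := by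
  induction j generalizing v with
  | zero => rfl
  | succ j ih =>
    refine (ih ((SlotTree.path l hl).parent v)).trans ?_
    show ((v : ℕ) - 1) - j = _
    omega

theorem SlotTree.path_depth {n h : ℕ} (l : Fin h → Fin n) (hl : StrictMono l)
    (v : Fin (h + 1)) : (SlotTree.path l hl).depth v = (v : ℕ) := by
  have key : {j : ℕ | (SlotTree.path l hl).parent^[j] v = (SlotTree.path l hl).root}
      = {j : ℕ | (v : ℕ) ≤ j} := by
    ext j
    have h0 : (SlotTree.path l hl).root = (0 : Fin (h + 1)) := rfl
    have h1 := SlotTree.path_iterate l hl j v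
    constructor
    · intro hj
      have h2 : (SlotTree.path l hl).parent^[j] v = (0 : Fin (h + 1)) := hj
      rw [h2] at h1
      simp only [Fin.val_zero] at h1
      show (v : ℕ) ≤ j
      omega
    · intro hj
      have hj' : (v : ℕ) ≤ j := hj
      show (SlotTree.path l hl).parent^[j] v = (0 : Fin (h + 1))
      apply Fin.ext
      rw [h1]
      simp only [Fin.val_zero]
      omega
  unfold SlotTree.depth
  rw [key]
  exact le_antisymm (Nat.sInf_le (le_refl (v : ℕ))) (le_csInf ⟨_, le_refl (v : ℕ)⟩ fun _ h => h)

/-- Every string has a closed fork, namely the path through its honest slots. -/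
theorem exists_closed_fork {n : ℕ} (w : Fin n → Bool) : ∃ F : Fork w, F.Closed := by
  classical
  let H : Finset (Fin n) := Finset.univ.filter fun i => w i = false
  let l := H.orderEmbOfFin rfl
  have hw : ∀ j, w (l j) = false := fun j =>
    (Finset.mem_filter.1 (H.orderEmbOfFin_mem rfl j)).2
  have hsurj : ∀ i, w i = false → ∃ j, l j = i := fun i hi => by
    have : i ∈ Set.range l := by
      rw [Finset.range_orderEmbOfFin]; simp [H, hi]
    exact this
  let T := SlotTree.path l l.strictMono
  have hsucc : ∀ j : Fin H.card, T.label (Fin.succ j) = (l j : ℕ) + 1 := fun j => rfl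
  have hzero : T.label (0 : Fin (H.card + 1)) = 0 := rfl
  refine ⟨{ toSlotTree := T, existsUnique_honest := ?_, honest_depth_lt := ?_ }, ?_⟩
  · intro i hi
    obtain ⟨j, rfl⟩ := hsurj i hi
    refine ⟨Fin.succ j, hsucc j, fun v hv => ?_⟩
    rcases Fin.eq_zero_or_eq_succ (show Fin (H.card + 1) from v) with h0 | ⟨j', h0⟩
    · have hv' : T.label v = (l j : ℕ) + 1 := hv
      rw [show v = (0 : Fin (H.card + 1)) from h0, hzero] at hv'
      omega
    · have hv' : T.label v = (l j : ℕ) + 1 := hv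
      rw [show v = Fin.succ j' from h0, hsucc] at hv'
      have : j' = j := l.injective (Fin.ext (by omega))
      exact (show v = Fin.succ j' from h0).trans (by rw [this])
  · intro u v hu hv huv
    show SlotTree.depth (SlotTree.path l l.strictMono) u
      < SlotTree.depth (SlotTree.path l l.strictMono) v
    refine ((SlotTree.path_depth _ _ u).trans_lt ?_).trans_eq (SlotTree.path_depth _ _ v).symm
    change T.label u < T.label v at huv
    rcases Fin.eq_zero_or_eq_succ (show Fin (H.card + 1) from v) with h0 | ⟨j', h0⟩
    · rw [show v = (0 : Fin (H.card + 1)) from h0, hzero] at huv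
      omega
    · rcases Fin.eq_zero_or_eq_succ (show Fin (H.card + 1) from u) with h1 | ⟨j, h1⟩
      · rw [show v = Fin.succ j' from h0, show u = (0 : Fin (H.card + 1)) from h1]
        simp
      · rw [show v = Fin.succ j' from h0, show u = Fin.succ j from h1, hsucc, hsucc] at huv
        have : j < j' := l.lt_iff_lt.1 (Fin.lt_def.2 (by omega))
        rw [show v = Fin.succ j' from h0, show u = Fin.succ j from h1]
        exact Fin.lt_def.1 (Fin.succ_lt_succ_iff.2 this)
  · by_cases hH : H.card = 0
    · right
      intro v
      have h2 : ((show Fin (H.card + 1) from v) : ℕ) < H.card + 1 :=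
        (show Fin (H.card + 1) from v).2
      exact Fin.ext (by show ((show Fin (H.card + 1) from v) : ℕ) = 0; omega)
    · left
      intro v hv
      rcases Fin.eq_zero_or_eq_succ (show Fin (H.card + 1) from v) with h0 | ⟨j, h0⟩
      · exfalso
        have h3 : (⟨1, by omega⟩ : Fin (H.card + 1)) ≠ 0 := by
          intro h; simpa using congrArg Fin.val h
        refine hv (⟨1, by omega⟩ : Fin (H.card + 1)) h3 ?_
        exact Eq.trans (Fin.ext rfl) h0.symm
      · refine ⟨l j, hw j, ?_⟩
        show T.label v = _
        rw [show v = Fin.succ j from h0, hsucc]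

theorem relMargin_isGreatest {m k : ℕ} (x : Fin m → Bool) (y : Fin k → Bool) :
    IsGreatest (relMarginValues x y) (relMargin x y) := by
  have hne : (relMarginValues x y).Nonempty := by
    obtain ⟨F, hF⟩ := exists_closed_fork (Fin.append x y)
    exact ⟨_, F, hF, rfl⟩
  have hb : BddAbove (relMarginValues x y) := by
    refine ⟨((m + k : ℕ) : ℤ), ?_⟩
    rintro z ⟨F, -, rfl⟩
    exact F.marginValues_le m (F.margin_isGreatest m).1
  exact ⟨Int.csSup_mem hne hb, fun z hz => le_csSup hb hz⟩

/-! Nonnegative relative margin is equivalent to the existence of a balanced fork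
(`hasBalancedFork_iff`): dishonest branches can be pruned without losing reach, and a tine of
nonnegative reach has enough later adversarial slots to be extended to full height. Balanced forks
need not be closed, so their existence is monotone in the string (`exists_balanced_mono`). Given the
past, a bit under the martingale condition is at most as likely to be `1` as an independent one, so
upper sets are most probable under independent bits (`EpsMartingale.real_preimage_le`). This yields
the first inequality.

For the exponential bound, reach and margin are controlled prefix by prefix by a walk (r, μ)
(`Fork.min_prefixReach_le_marginSeq`): a `1` raises both coordinates, a `0` lowers both, except that
r is stopped at 0 and μ stays at 0 while r > 0. Only this upper bound is needed. With β = p / (1 -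
p), an explicit potential, equal to z^r where μ ≥ 0, contracts in mean by θ = pz + (1 - p)/z at each
symbol of y (`potential_step_le`). The reach after x has a geometric tail whatever its length
(`bernoulliMean_reach_tail`), so the starting value of the potential is bounded uniformly in m.
Taking z = 1 + ε² gives θ ≤ exp(-ε³(1 - ε)), about twice the required rate; the surplus absorbs the
prefactor for large k, and small k is covered by a one-step estimate (`marginProb_le_two_mul`). -/

/-! ### Depth and tines in labelled trees. -/

namespace SlotTree

variable {n : ℕ} (F : SlotTree n)

theorem exists_iterate_eq_root (v : F.V) : ∃ j, F.parent^[j] v = F.root := by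
  induction hl : F.label v using Nat.strong_induction_on generalizing v with
  | _ l ih =>
    by_cases hv : v = F.root
    · exact ⟨0, hv⟩
    · obtain ⟨j, hj⟩ := ih _ (hl ▸ F.label_parent_lt v hv) (F.parent v) rfl
      exact ⟨j + 1, hj⟩

theorem iterate_depth (v : F.V) : F.parent^[F.depth v] v = F.root :=
  Nat.sInf_mem (F.exists_iterate_eq_root v)

theorem depth_root : F.depth F.root = 0 :=
  Nat.sInf_eq_zero.2 (Or.inl rfl)

theorem depth_eq_succ {v : F.V} (hv : v ≠ F.root) : F.depth v = F.depth (F.parent v) + 1 := by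
  apply le_antisymm
  · exact Nat.sInf_le (show F.parent^[F.depth (F.parent v) + 1] v = F.root from
      F.iterate_depth (F.parent v))
  · have h := F.iterate_depth v
    cases hd : F.depth v with
    | zero => rw [hd] at h; exact absurd h hv
    | succ j =>
      rw [hd] at h
      exact Nat.succ_le_succ (Nat.sInf_le (show F.parent^[j] (F.parent v) = F.root from h))

/-- The depth is determined by its recursion along edges. -/
theorem depth_eq_of_recursion {d : F.V → ℕ} (h0 : d F.root = 0)
    (hs : ∀ v, v ≠ F.root → d v = d (F.parent v) + 1) (v : F.V) : F.depth v = d v := by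
  induction hl : F.label v using Nat.strong_induction_on generalizing v with
  | _ l ih =>
    by_cases hv : v = F.root
    · rw [hv, F.depth_root, h0]
    · rw [F.depth_eq_succ hv, hs v hv, ih _ (hl ▸ F.label_parent_lt v hv) _ rfl]

theorem depth_le_height (v : F.V) : F.depth v ≤ F.height := Finset.le_sup (Finset.mem_univ v)

theorem ne_root_of_label_pos {v : F.V} (h : 0 < F.label v) : v ≠ F.root := by
  rintro rfl
  rw [F.label_root] at h
  exact lt_irrefl _ h

theorem onTine_refl (v : F.V) : F.OnTine v v := ⟨0, rfl⟩

theorem onTine_of_parent {u v : F.V} (h : F.OnTine u (F.parent v)) : F.OnTine u v := by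
  obtain ⟨j, hj⟩ := h
  exact ⟨j + 1, hj⟩

theorem onTine_iff {u v : F.V} : F.OnTine u v ↔ u = v ∨ F.OnTine u (F.parent v) := by
  constructor
  · rintro ⟨j, hj⟩
    cases j with
    | zero => exact Or.inl hj.symm
    | succ j => exact Or.inr ⟨j, hj⟩
  · rintro (rfl | h)
    · exact F.onTine_refl u
    · exact F.onTine_of_parent h

theorem shareEdgeAfter_of_parent_left {m : ℕ} {u v : F.V}
    (h : F.ShareEdgeAfter m (F.parent u) v) : F.ShareEdgeAfter m u v := by
  obtain ⟨a, h1, h2, h3⟩ := h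
  exact ⟨a, h1, F.onTine_of_parent h2, h3⟩

theorem shareEdgeAfter_comm {m : ℕ} {u v : F.V} :
    F.ShareEdgeAfter m u v ↔ F.ShareEdgeAfter m v u := by
  constructor <;> exact fun ⟨a, h1, h2, h3⟩ => ⟨a, h1, h3, h2⟩

end SlotTree

/-! ### The recurrences for reach and margin. -/

/-- One step of the recurrence for the maximal reach. -/
def reachStep (r : ℤ) (b : Bool) : ℤ := if b then r + 1 else max (r - 1) 0

/-- One step of the recurrence for the relative margin. -/
def marginStep (r μ : ℤ) (b : Bool) : ℤ :=
  if b then μ + 1 else if μ = 0 ∧ 0 < r then 0 else μ - 1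

/-- The recurrence for the maximal reach of the prefix of length `t`. -/
def reachSeq (b : ℕ → Bool) : ℕ → ℤ
  | 0 => 0
  | t + 1 => reachStep (reachSeq b t) (b t)

/-- The recurrence for the margin of the prefix of length `t` relative to that of length `m`. -/
def marginSeq (b : ℕ → Bool) (m : ℕ) : ℕ → ℤ
  | 0 => 0
  | t + 1 => if t < m then reachSeq b (t + 1) else marginStep (reachSeq b t) (marginSeq b m t) (b t)

/-- A finite string, continued by honest symbols. -/
def padBits {n : ℕ} (w : Fin n → Bool) (i : ℕ) : Bool := if h : i < n then w ⟨i, h⟩ else false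

theorem reachSeq_nonneg (b : ℕ → Bool) (t : ℕ) : 0 ≤ reachSeq b t := by
  induction t with
  | zero => exact le_rfl
  | succ t ih => simp only [reachSeq, reachStep]; split_ifs <;> omega

theorem marginSeq_eq_reachSeq (b : ℕ → Bool) {m t : ℕ} (h : t ≤ m) :
    marginSeq b m t = reachSeq b t := by
  cases t with
  | zero => rfl
  | succ t => exact if_pos h

theorem marginSeq_succ (b : ℕ → Bool) {m t : ℕ} (h : m ≤ t) :
    marginSeq b m (t + 1) = marginStep (reachSeq b t) (marginSeq b m t) (b t) := by
  simp only [marginSeq]; rw [if_neg (by omega)]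

/-- The margin escapes a decrement only by staying at 0, and the reach never falls below 0. -/
theorem marginSeq_le_reachSeq (b : ℕ → Bool) (m t : ℕ) : marginSeq b m t ≤ reachSeq b t := by
  induction t with
  | zero => exact le_rfl
  | succ t ih =>
    have := reachSeq_nonneg b t
    simp only [marginSeq, reachSeq, marginStep, reachStep]
    split_ifs <;> omega

theorem reachSeq_congr {b b' : ℕ → Bool} {t : ℕ} (h : ∀ i < t, b i = b' i) :
    reachSeq b t = reachSeq b' t := by
  induction t with
  | zero => rfl
  | succ t ih =>
    simp only [reachSeq]
    rw [ih fun i hi => h i (by omega), h t (by omega)]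

theorem marginSeq_congr {b b' : ℕ → Bool} (m : ℕ) {t : ℕ} (h : ∀ i < t, b i = b' i) :
    marginSeq b m t = marginSeq b' m t := by
  induction t with
  | zero => rfl
  | succ t ih =>
    simp only [marginSeq]
    rw [ih fun i hi => h i (by omega), h t (by omega), reachSeq_congr h,
      reachSeq_congr fun i hi => h i (by omega)]

/-! ### The recurrences bound every fork. -/

namespace Fork

variable {n : ℕ} {w : Fin n → Bool} (F : Fork w)

/-- The adversarial slots among the first `t` after the label of `v`. -/
def reserveUpTo (t : ℕ) (v : F.V) : ℕ :=
  ((Finset.range t).filter fun i => padBits w i = true ∧ F.label v < i + 1).card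

open Classical in
/-- The largest depth of an honest vertex among the first `t` slots. -/
noncomputable def honestHeight (t : ℕ) : ℕ :=
  (Finset.univ.filter fun v => F.IsHonest w v ∧ F.label v ≤ t).sup F.depth

/-- The reach of `v` within the first `t` slots, measured against the honest vertices. -/
noncomputable def prefixReach (t : ℕ) (v : F.V) : ℤ :=
  F.reserveUpTo t v + F.depth v - F.honestHeight t

theorem reserveUpTo_succ (t : ℕ) (v : F.V) (h : F.label v ≤ t) :
    F.reserveUpTo (t + 1) v = F.reserveUpTo t v + if padBits w t then 1 else 0 := by
  unfold reserveUpTo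
  rw [Finset.range_add_one, Finset.filter_insert]
  by_cases hb : padBits w t = true
  · rw [if_pos ⟨hb, by omega⟩, if_pos hb, Finset.card_insert_of_notMem (by simp)]
  · rw [if_neg (by tauto), if_neg hb, add_zero]

theorem reserveUpTo_of_le (t : ℕ) (v : F.V) (h : t ≤ F.label v) : F.reserveUpTo t v = 0 := by
  unfold reserveUpTo
  rw [Finset.card_eq_zero, Finset.filter_eq_empty_iff]
  intro i hi
  rw [Finset.mem_range] at hi
  omega

theorem isHonest_iff (v : F.V) :
    F.IsHonest w v ↔ ∃ i < n, padBits w i = false ∧ F.label v = i + 1 := by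
  constructor
  · rintro ⟨i, h1, h2⟩
    exact ⟨i, i.2, by simp [padBits, h1], h2⟩
  · rintro ⟨i, hi, h1, h2⟩
    exact ⟨⟨i, hi⟩, by simpa [padBits, hi] using h1, h2⟩

theorem honestHeight_succ_of_adversarial (t : ℕ) (hb : padBits w t = true) :
    F.honestHeight (t + 1) = F.honestHeight t := by
  unfold honestHeight
  congr 1
  ext v
  simp only [Finset.mem_filter, Finset.mem_univ, true_and]
  refine and_congr_right fun hv => ?_
  obtain ⟨i, -, h1, h2⟩ := (F.isHonest_iff v).1 hv
  have : i ≠ t := by rintro rfl; simp [hb] at h1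
  omega

/-- An honest slot carries a vertex that exceeds all earlier honest depths. -/
theorem exists_honest_vertex (t : ℕ) (ht : t < n) (hb : padBits w t = false) :
    ∃ v, F.label v = t + 1 ∧ (∀ u, F.label u = t + 1 → u = v) ∧
      F.honestHeight (t + 1) = F.depth v ∧ F.honestHeight t < F.depth v := by
  have hw : w ⟨t, ht⟩ = false := by simpa [padBits, ht] using hb
  obtain ⟨v, hv, huniq⟩ := F.existsUnique_honest ⟨t, ht⟩ hw
  have hv' : F.label v = t + 1 := hv
  have hvh : F.IsHonest w v := ⟨⟨t, ht⟩, hw, hv⟩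
  have hlt : F.honestHeight t < F.depth v := by
    unfold honestHeight
    -- The supremum over no vertices is 0, so strictness also requires that `v` have positive depth.
    refine (Finset.sup_lt_iff ?_).2 fun u hu => ?_
    · rw [F.depth_eq_succ (F.ne_root_of_label_pos (by omega))]
      exact Nat.succ_pos _
    · simp only [Finset.mem_filter, Finset.mem_univ, true_and] at hu
      exact F.honest_depth_lt u v hu.1 hvh (by omega)
  refine ⟨v, hv, huniq, ?_, hlt⟩
  apply le_antisymm
  · unfold honestHeight
    refine Finset.sup_le fun u hu => ?_
    simp only [Finset.mem_filter, Finset.mem_univ, true_and] at hu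
    rcases Nat.lt_or_ge (F.label u) (F.label v) with h | h
    · exact (F.honest_depth_lt u v hu.1 hvh h).le
    · rw [huniq u (show F.label u = t + 1 by omega)]
  · exact Finset.le_sup (f := F.depth) (by simp [hvh, hv'])

theorem prefixReach_succ_of_adversarial (t : ℕ) (hb : padBits w t = true) (v : F.V)
    (h : F.label v ≤ t) : F.prefixReach (t + 1) v = F.prefixReach t v + 1 := by
  unfold prefixReach
  rw [F.honestHeight_succ_of_adversarial t hb, F.reserveUpTo_succ t v h, if_pos hb]
  push_cast
  ring

/-- The edge into `v` is worth one unit of depth; the parent keeps the new slot in reserve instead,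
also worth one unit. -/
theorem prefixReach_le_parent (t : ℕ) (hb : padBits w t = true) (v : F.V)
    (h : F.label v = t + 1) : F.prefixReach (t + 1) v ≤ F.prefixReach t (F.parent v) + 1 := by
  have hr := F.ne_root_of_label_pos (v := v) (by omega)
  have hl := F.label_parent_lt v hr
  rw [← F.prefixReach_succ_of_adversarial t hb _ (by omega)]
  unfold prefixReach
  rw [F.reserveUpTo_of_le (t + 1) v h.ge, F.depth_eq_succ hr,
    F.reserveUpTo_succ t _ (by omega), if_pos hb]
  push_cast
  omega

theorem prefixReach_succ_of_honest (t : ℕ) (hb : padBits w t = false) (v : F.V)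
    (h : F.label v ≤ t) : F.prefixReach (t + 1) v =
      F.prefixReach t v + F.honestHeight t - F.honestHeight (t + 1) := by
  unfold prefixReach
  rw [F.reserveUpTo_succ t v h, if_neg (by simp [hb])]
  push_cast
  ring

/-- At an honest slot the new vertex has reach exactly 0, which is the floor in `reachStep`, while
the honest height grows and every older vertex loses at least 1. -/
theorem prefixReach_le_reachSeq (t : ℕ) (ht : t ≤ n) (v : F.V) (hv : F.label v ≤ t) :
    F.prefixReach t v ≤ reachSeq (padBits w) t := by
  induction t generalizing v with
  | zero =>
    have : v = F.root := by
      by_contra hr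
      have := F.label_parent_lt v hr
      omega
    subst this
    unfold prefixReach
    rw [F.reserveUpTo_of_le _ _ (Nat.zero_le _), F.depth_root]
    simp [reachSeq]
  | succ t ih =>
    simp only [reachSeq, reachStep]
    rcases Bool.eq_false_or_eq_true (padBits w t) with hb | hb
    · rw [if_pos hb]
      rcases Nat.lt_or_ge t (F.label v) with h | h
      · have hl := F.label_parent_lt v (F.ne_root_of_label_pos (by omega))
        have := F.prefixReach_le_parent t hb v (by omega)
        have := ih (by omega) (F.parent v) (by omega)
        omega
      · rw [F.prefixReach_succ_of_adversarial t hb v h]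
        have := ih (by omega) v h
        omega
    · rw [if_neg (by simp [hb])]
      obtain ⟨s, hs, huniq, hh, hlt⟩ := F.exists_honest_vertex t (by omega) hb
      rcases Nat.lt_or_ge t (F.label v) with h | h
      · rw [huniq v (by omega)]
        unfold prefixReach
        rw [hh, F.reserveUpTo_of_le _ _ hs.ge]
        simp
      · rw [F.prefixReach_succ_of_honest t hb v h, hh]
        have := ih (by omega) v h
        omega

/-- The recurrence bounds the margin within each prefix of the string. -/
theorem min_prefixReach_le_marginSeq {m : ℕ} (t : ℕ) (hm : m ≤ t) (ht : t ≤ n) (u v : F.V)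
    (hu : F.label u ≤ t) (hv : F.label v ≤ t) (hs : ¬ F.ShareEdgeAfter m u v) :
    min (F.prefixReach t u) (F.prefixReach t v) ≤ marginSeq (padBits w) m t := by
  induction t, hm using Nat.le_induction generalizing u v with
  | base =>
    rw [marginSeq_eq_reachSeq _ le_rfl]
    exact (min_le_left _ _).trans (F.prefixReach_le_reachSeq m ht u hu)
  | succ t hm ih =>
    rw [marginSeq_succ _ hm]
    have hpar : ∀ v : F.V, F.label v = t + 1 → F.label (F.parent v) ≤ t := fun v hv => by
      have := F.label_parent_lt v (F.ne_root_of_label_pos (by omega))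
      omega
    have hs' := fun h => hs (F.shareEdgeAfter_comm.1 h)
    simp only [marginStep]
    rcases Bool.eq_false_or_eq_true (padBits w t) with hb | hb
    · rw [if_pos hb]
      -- A vertex in the new adversarial slot is replaced by its parent: shortening a tine creates
      -- no shared edge.
      have key : ∀ v : F.V, F.label v ≤ t + 1 → ∃ v', F.label v' ≤ t ∧
          F.prefixReach (t + 1) v ≤ F.prefixReach t v' + 1 ∧ ∀ u, ¬ F.ShareEdgeAfter m v u →
            ¬ F.ShareEdgeAfter m v' u := fun v hv => by
        rcases Nat.lt_or_ge t (F.label v) with h | h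
        · exact ⟨F.parent v, hpar v (by omega), F.prefixReach_le_parent t hb v (by omega),
            fun u h1 h2 => h1 (F.shareEdgeAfter_of_parent_left h2)⟩
        · exact ⟨v, h, (F.prefixReach_succ_of_adversarial t hb v h).le, fun u h => h⟩
      obtain ⟨u', hu1, hu2, hu3⟩ := key u hu
      obtain ⟨v', hv1, hv2, hv3⟩ := key v hv
      have := ih (by omega) u' v' hu1 hv1 fun h =>
        hv3 u' (fun h => hu3 v hs (F.shareEdgeAfter_comm.1 h)) (F.shareEdgeAfter_comm.1 h)
      omega
    · rw [if_neg (by simp [hb])]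
      obtain ⟨s, hsl, huniq, hh, hlt⟩ := F.exists_honest_vertex t (by omega) hb
      have hs0 : F.prefixReach (t + 1) s = 0 := by
        unfold prefixReach
        rw [hh, F.reserveUpTo_of_le _ _ hsl.ge]
        simp
      have hsr := F.ne_root_of_label_pos (v := s) (by omega)
      -- The new honest vertex is deeper than all earlier honest ones, so its parent is at least as
      -- deep as they are.
      have hps : 0 ≤ F.prefixReach t (F.parent s) := by
        have := F.depth_eq_succ hsr
        unfold prefixReach
        omega
      -- The induction hypothesis is applied to `v` and the parent of `s`. If the margin is
      -- negative, `v` must be the tine that bounds it, and it loses at least 1. If margin and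
      -- maximal reach are both 0, `v` had reach at most 0 and becomes negative. Otherwise the bound
      -- 0 suffices.
      have key : ∀ v : F.V, F.label v ≤ t → ¬ F.ShareEdgeAfter m s v →
          min 0 (F.prefixReach (t + 1) v) ≤
            if marginSeq (padBits w) m t = 0 ∧ 0 < reachSeq (padBits w) t then 0
            else marginSeq (padBits w) m t - 1 := fun v hv hsv => by
        have h1 := ih (by omega) (F.parent s) v (hpar s hsl) hv fun h =>
          hsv (F.shareEdgeAfter_of_parent_left h)
        have h2 := F.prefixReach_le_reachSeq t (by omega) v hv
        have h3 := F.prefixReach_succ_of_honest t hb v hv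
        have h4 := marginSeq_le_reachSeq (padBits w) m t
        split_ifs <;> omega
      rcases Nat.lt_or_ge t (F.label u) with h | h <;> rcases Nat.lt_or_ge t (F.label v) with h' | h'
      · rw [huniq u (by omega), huniq v (by omega)] at hs
        exact absurd ⟨s, by omega, F.onTine_refl s, F.onTine_refl s⟩ hs
      · rw [huniq u (by omega)] at hs ⊢
        rw [hs0]
        exact key v h' hs
      · rw [huniq v (by omega)] at hs' ⊢
        rw [hs0, min_comm]
        exact key u h hs'
      · have h1 := ih (by omega) u v h h' hs
        have h2 := F.prefixReach_succ_of_honest t hb u h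
        have h3 := F.prefixReach_succ_of_honest t hb v h'
        split_ifs <;> omega

theorem honestHeight_le_height (t : ℕ) : F.honestHeight t ≤ F.height :=
  Finset.sup_le fun v _ => F.depth_le_height v

/-- A tine of full length is at least as long as the honest height, hence has nonnegative prefix
reach. Closedness plays no role. -/
theorem Balanced.marginSeq_nonneg {F : Fork w} {m : ℕ} (hm : m ≤ n) (h : F.Balanced m) :
    0 ≤ marginSeq (padBits w) m n := by
  obtain ⟨u, v, hs, hu, hv⟩ := h
  have := F.min_prefixReach_le_marginSeq n hm le_rfl u v (F.label_le u) (F.label_le v) hs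
  have h1 := F.honestHeight_le_height n
  unfold prefixReach at this
  omega

end Fork

theorem HasBalancedFork.marginSeq_nonneg {m k : ℕ} {x : Fin m → Bool} {y : Fin k → Bool}
    (h : HasBalancedFork x y) : 0 ≤ marginSeq (padBits (Fin.append x y)) m (m + k) := by
  obtain ⟨F, hF⟩ := h
  exact hF.marginSeq_nonneg (Nat.le_add_right m k)

/-! ### Balanced forks and nonnegative margin. -/

namespace SlotTree

variable {n : ℕ} (F : SlotTree n)

theorem onTine_trans {u v t : F.V} (h1 : F.OnTine u v) (h2 : F.OnTine v t) : F.OnTine u t := by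
  obtain ⟨i, rfl⟩ := h1
  obtain ⟨j, rfl⟩ := h2
  exact ⟨i + j, Function.iterate_add_apply _ _ _ _⟩

theorem eq_root_of_isLeaf_root (h : F.IsLeaf F.root) (v : F.V) : v = F.root := by
  induction hl : F.label v using Nat.strong_induction_on generalizing v with
  | _ l ih =>
    by_contra hv
    exact h v hv (ih _ (hl ▸ F.label_parent_lt v hv) _ rfl)

end SlotTree

namespace Fork

variable {n : ℕ} {w : Fin n → Bool} (F : Fork w)

/-- The vertices that remain when dishonest leaves are removed repeatedly. -/
def Kept (v : F.V) : Prop := v = F.root ∨ ∃ u, F.IsHonest w u ∧ F.OnTine v u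

variable {F} in
theorem Kept.parent {v : F.V} (h : F.Kept v) : F.Kept (F.parent v) := by
  rcases h with rfl | ⟨u, hu, j, rfl⟩
  · exact Or.inl F.parent_root
  · exact Or.inr ⟨u, hu, j + 1, Function.iterate_succ_apply' _ _ _⟩

open Classical in
/-- The tree of the vertices that remain when dishonest leaves are removed repeatedly. -/
noncomputable def trimTree : SlotTree n where
  V := {v : F.V // F.Kept v}
  root := ⟨F.root, Or.inl rfl⟩
  parent v := ⟨F.parent v, v.2.parent⟩
  parent_root := Subtype.ext F.parent_root
  label v := F.label v
  label_le v := F.label_le v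
  label_root := F.label_root
  label_parent_lt v hv := F.label_parent_lt v fun h => hv (Subtype.ext h)

theorem trimTree_depth (v : {v : F.V // F.Kept v}) : F.trimTree.depth v = F.depth v.1 :=
  F.trimTree.depth_eq_of_recursion (d := fun v => F.depth (Subtype.val v)) F.depth_root
    (fun _ hv => F.depth_eq_succ fun h => hv (Subtype.ext h)) v

/-- The closed fork obtained by removing dishonest leaves repeatedly. -/
noncomputable def trim : Fork w where
  toSlotTree := F.trimTree
  existsUnique_honest i hi := by
    obtain ⟨v, hv, huniq⟩ := F.existsUnique_honest i hi
    exact ⟨⟨v, Or.inr ⟨v, ⟨i, hi, hv⟩, F.onTine_refl v⟩⟩, hv,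
      fun u hu => Subtype.ext (huniq u.1 hu)⟩
  honest_depth_lt u v hu hv huv := by
    have h := F.honest_depth_lt u.1 v.1 hu hv huv
    exact (F.trimTree_depth u).trans_lt (h.trans_eq (F.trimTree_depth v).symm)

/-- A kept vertex that is neither the root nor honest lies strictly below an honest vertex's end of
a tine, so it has a kept child. -/
theorem trim_closed : F.trim.Closed := by
  by_cases hr : F.trim.IsLeaf F.trim.root
  · exact Or.inr (F.trim.eq_root_of_isLeaf_root hr)
  · refine Or.inl fun v hv => ?_
    have hvr : v ≠ F.trim.root := fun h => hr (h ▸ hv)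
    obtain ⟨v, h | ⟨u, hu, j, hj⟩⟩ := v
    · exact absurd (Subtype.ext h) hvr
    · cases j with
      | zero => subst hj; exact hu
      | succ j =>
        rw [Function.iterate_succ_apply'] at hj
        refine absurd (Subtype.ext hj) (hv ⟨F.parent^[j] u, Or.inr ⟨u, hu, j, rfl⟩⟩ fun h => ?_)
        have h' : F.parent^[j] u = F.root := congrArg Subtype.val h
        rw [h', F.parent_root] at hj
        exact hvr (Subtype.ext hj.symm)

theorem trim_height_le : F.trim.height ≤ F.height :=
  Finset.sup_le fun v _ => (F.trimTree_depth v).trans_le (F.depth_le_height v.1)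

theorem trim_onTine {u v : F.trim.V} (h : F.trim.OnTine u v) : F.OnTine u.1 v.1 := by
  obtain ⟨j, rfl⟩ := h
  refine ⟨j, ?_⟩
  induction j generalizing v with
  | zero => rfl
  | succ j ih => exact ih (v := F.trim.parent v)

/-- The slot of `v` itself is adversarial and comes after the label of the parent. -/
theorem reserve_lt_parent {v : F.V} (hr : v ≠ F.root) (hv : ¬ F.IsHonest w v) :
    F.reserve v + 1 ≤ F.reserve (F.parent v) := by
  have hl := F.label_parent_lt v hr
  have hn := F.label_le v
  have hw : w ⟨F.label v - 1, by omega⟩ = true := by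
    by_contra h
    exact hv ⟨⟨F.label v - 1, by omega⟩, by simpa using h, by dsimp only; omega⟩
  refine Finset.card_lt_card ⟨fun i hi => ?_, fun h => ?_⟩
  · simp only [Finset.mem_filter, Finset.mem_univ, true_and] at hi ⊢
    exact ⟨hi.1, hl.trans hi.2⟩
  · have := @h ⟨F.label v - 1, by omega⟩ (by simp [hw]; omega)
    simp only [Finset.mem_filter, Finset.mem_univ, true_and] at this
    omega

/-- Each step back over a removed vertex loses one unit of depth and recovers at least one of
reserve. -/
theorem exists_kept (t : F.V) : ∃ v, F.Kept v ∧ F.OnTine v t ∧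
    F.depth t + F.reserve t ≤ F.depth v + F.reserve v := by
  induction hl : F.label t using Nat.strong_induction_on generalizing t with
  | _ l ih =>
    by_cases ht : F.Kept t
    · exact ⟨t, ht, F.onTine_refl t, le_rfl⟩
    · have hr : t ≠ F.root := fun h => ht (Or.inl h)
      obtain ⟨v, h1, h2, h3⟩ := ih _ (hl ▸ F.label_parent_lt t hr) _ rfl
      refine ⟨v, h1, F.onTine_of_parent h2, ?_⟩
      have := F.reserve_lt_parent hr fun h => ht (Or.inr ⟨t, h, F.onTine_refl t⟩)
      have := F.depth_eq_succ hr
      omega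

variable {F} in
theorem Balanced.trim_margin_nonneg {m : ℕ} (h : F.Balanced m) : 0 ≤ F.trim.margin m := by
  obtain ⟨t₁, t₂, hs, h1, h2⟩ := h
  obtain ⟨v₁, hk₁, ht₁, hr₁⟩ := F.exists_kept t₁
  obtain ⟨v₂, hk₂, ht₂, hr₂⟩ := F.exists_kept t₂
  have hs' : ¬ F.trim.ShareEdgeAfter m ⟨v₁, hk₁⟩ ⟨v₂, hk₂⟩ := by
    rintro ⟨u, hu, hu1, hu2⟩
    exact hs ⟨u.1, hu, F.onTine_trans (F.trim_onTine hu1) ht₁,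
      F.onTine_trans (F.trim_onTine hu2) ht₂⟩
  have hreach : ∀ v (hk : F.Kept v), F.height ≤ F.depth v + F.reserve v →
      0 ≤ F.trim.reach ⟨v, hk⟩ := fun v hk hv => by
    have hd : F.trim.depth ⟨v, hk⟩ = F.depth v := F.trimTree_depth ⟨v, hk⟩
    have hres : F.trim.reserve ⟨v, hk⟩ = F.reserve v := rfl
    -- Pruning may lower the height, which only increases reach.
    have := F.trim_height_le
    unfold reach gap
    rw [hres, hd]
    omega
  refine le_trans ?_ ((F.trim.margin_isGreatest m).2 ⟨_, _, hs', rfl⟩)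
  exact le_min (hreach v₁ hk₁ (by omega)) (hreach v₂ hk₂ (by omega))

/-- Attach a new leaf with label `i + 1` to `v`. -/
def addLeafTree (v : F.V) (i : Fin n) (hl : F.label v < i + 1) : SlotTree n where
  V := Option F.V
  root := some F.root
  parent u := u.elim (some v) fun u => some (F.parent u)
  parent_root := congrArg some F.parent_root
  label u := u.elim (i + 1) F.label
  label_le u := match u with
    | none => i.2
    | some u => F.label_le u
  label_root := F.label_root
  label_parent_lt u hu := match u with
    | none => hl
    | some u => F.label_parent_lt u fun h => hu (congrArg some h)

theorem addLeafTree_depth (v : F.V) (i : Fin n) (hl : F.label v < i + 1) (u : Option F.V) :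
    (F.addLeafTree v i hl).depth u = u.elim (F.depth v + 1) F.depth :=
  (F.addLeafTree v i hl).depth_eq_of_recursion
    (d := fun u : Option F.V => u.elim (F.depth v + 1) F.depth) F.depth_root
    (fun u hu => match u with
      | none => rfl
      | some _ => F.depth_eq_succ fun h => hu (congrArg some h)) u

theorem addLeafTree_isHonest (v : F.V) (i : Fin n) (hl : F.label v < i + 1) (hi : w i = true)
    {u : Option F.V} (hu : (F.addLeafTree v i hl).IsHonest w u) :
    ∃ u', u = some u' ∧ F.IsHonest w u' := by
  cases u with
  | none =>
    obtain ⟨j, hj, h⟩ := hu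
    have h' : (i : ℕ) + 1 = j + 1 := h
    have : i = j := Fin.ext (by omega)
    rw [this, hj] at hi
    exact absurd hi (by simp)
  | some u => exact ⟨u, rfl, hu⟩

/-- Attach a new adversarial leaf with label `i + 1` to `v`. -/
def addLeaf (v : F.V) (i : Fin n) (hl : F.label v < i + 1) (hi : w i = true) : Fork w where
  toSlotTree := F.addLeafTree v i hl
  existsUnique_honest j hj := by
    obtain ⟨u, hu, huniq⟩ := F.existsUnique_honest j hj
    refine ⟨some u, hu, fun u' hu' => ?_⟩
    obtain ⟨u', rfl, -⟩ := F.addLeafTree_isHonest v i hl hi ⟨j, hj, hu'⟩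
    exact congrArg some (huniq u' hu')
  honest_depth_lt a b ha hb hab := by
    obtain ⟨a, rfl, ha⟩ := F.addLeafTree_isHonest v i hl hi ha
    obtain ⟨b, rfl, hb⟩ := F.addLeafTree_isHonest v i hl hi hb
    rw [addLeafTree_depth, addLeafTree_depth]
    exact F.honest_depth_lt a b ha hb hab

theorem addLeaf_onTine_some (v : F.V) (i : Fin n) (hl : F.label v < i + 1) (hi : w i = true)
    {u : (F.addLeaf v i hl hi).V} {t : F.V} (h : (F.addLeaf v i hl hi).OnTine u (some t)) :
    ∃ u', u = some u' ∧ F.OnTine u' t := by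
  obtain ⟨j, rfl⟩ := h
  induction j generalizing t with
  | zero => exact ⟨t, rfl, F.onTine_refl t⟩
  | succ j ih =>
    obtain ⟨u', h1, h2⟩ := ih (t := F.parent t)
    exact ⟨u', h1, F.onTine_of_parent h2⟩

/-- A tine of nonnegative reach that is not of maximal length can be extended by one edge. -/
theorem exists_extend {m : ℕ} {t₁ t₂ : F.V} (hs : ¬ F.ShareEdgeAfter m t₁ t₂)
    (h1 : 0 ≤ F.reach t₁) (h2 : 0 ≤ F.reach t₂) (hd : F.depth t₁ < F.height) :
    ∃ (G : Fork w) (s₁ s₂ : G.V), ¬ G.ShareEdgeAfter m s₁ s₂ ∧ 0 ≤ G.reach s₁ ∧ 0 ≤ G.reach s₂ ∧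
      G.height = F.height ∧ G.depth s₁ = F.depth t₁ + 1 ∧ G.depth s₂ = F.depth t₂ := by
  -- Nonnegative reach with a positive gap forces a positive reserve. The earliest available slot is
  -- used, so that the extension costs exactly the one unit of reserve by which the gap shrinks.
  have hpos : (Finset.univ.filter fun i : Fin n => w i = true ∧ F.label t₁ < i + 1).Nonempty := by
    rw [← Finset.card_pos]
    unfold reach gap reserve at h1
    omega
  obtain ⟨i, hi, hmin⟩ := Finset.exists_minimal hpos
  simp only [Finset.mem_filter, Finset.mem_univ, true_and] at hi hmin
  let G := F.addLeaf t₁ i hi.2 hi.1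
  have hd1 : G.depth none = F.depth t₁ + 1 := F.addLeafTree_depth t₁ i hi.2 none
  have hdo : ∀ u, G.depth (some u) = F.depth u := fun u => F.addLeafTree_depth t₁ i hi.2 (some u)
  have hht : G.height = F.height := by
    apply le_antisymm
    · refine Finset.sup_le fun u _ => ?_
      match u with
      | none => exact hd1.trans_le hd
      | some u => exact (hdo u).trans_le (F.depth_le_height u)
    · exact Finset.sup_le fun u _ => (hdo u).symm.trans_le (G.depth_le_height (some u))
  have hres : F.reserve t₁ ≤ G.reserve none + 1 := by
    refine le_trans (Finset.card_le_card (t := insert i (Finset.univ.filter fun j : Fin n =>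
      w j = true ∧ (i : ℕ) + 1 < j + 1)) fun j hj => ?_) (Finset.card_insert_le _ _)
    simp only [Finset.mem_insert, Finset.mem_filter, Finset.mem_univ, true_and] at hj ⊢
    rcases lt_trichotomy i j with h | h | h
    · exact Or.inr ⟨hj.1, by rw [Fin.lt_def] at h; omega⟩
    · exact Or.inl h.symm
    · exact absurd (hmin hj h.le) (not_le.2 h)
  refine ⟨G, none, some t₂, ?_, ?_, ?_, hht, hd1, hdo t₂⟩
  · rintro ⟨u, hu, hu1, hu2⟩
    obtain ⟨u, rfl, hu3⟩ := F.addLeaf_onTine_some t₁ i hi.2 hi.1 hu2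
    rcases G.onTine_iff.1 hu1 with h | h
    · exact absurd h (by rintro ⟨⟩)
    · obtain ⟨u', h', h⟩ := F.addLeaf_onTine_some t₁ i hi.2 hi.1 h
      obtain rfl := Option.some.inj h'
      exact hs ⟨u, hu, h, hu3⟩
  · unfold reach gap at h1 ⊢
    rw [hht, hd1]
    push_cast
    omega
  · have : G.reserve (some t₂) = F.reserve t₂ := rfl
    unfold reach gap at h2 ⊢
    rw [hht, hdo, this]
    exact h2

theorem exists_balanced_of_reach_nonneg {m : ℕ} (F : Fork w) {t₁ t₂ : F.V}
    (hs : ¬ F.ShareEdgeAfter m t₁ t₂) (h1 : 0 ≤ F.reach t₁) (h2 : 0 ≤ F.reach t₂) :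
    ∃ G : Fork w, G.Balanced m := by
  induction hN : (F.height - F.depth t₁) + (F.height - F.depth t₂) generalizing F with
  | zero =>
    have := F.depth_le_height t₁
    have := F.depth_le_height t₂
    exact ⟨F, t₁, t₂, hs, by omega, by omega⟩
  | succ N ih =>
    by_cases hd : F.depth t₁ < F.height
    · obtain ⟨G, s₁, s₂, a, b, c, d, e, f⟩ := F.exists_extend hs h1 h2 hd
      exact ih G a b c (by omega)
    · obtain ⟨G, s₁, s₂, a, b, c, d, e, f⟩ :=
        F.exists_extend (fun h => hs (F.shareEdgeAfter_comm.1 h)) h2 h1 (by omega)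
      exact ih G a b c (by omega)

/-- A fork remains one when honest slots become adversarial. -/
def ofLE {w' : Fin n → Bool} (h : w ≤ w') : Fork w' where
  toSlotTree := F.toSlotTree
  existsUnique_honest i hi := F.existsUnique_honest i (le_bot_iff.1 ((h i).trans_eq hi))
  honest_depth_lt u v := fun ⟨i, hi, hu⟩ ⟨j, hj, hv⟩ =>
    F.honest_depth_lt u v ⟨i, le_bot_iff.1 ((h i).trans_eq hi), hu⟩
      ⟨j, le_bot_iff.1 ((h j).trans_eq hj), hv⟩

end Fork

theorem hasBalancedFork_iff {m k : ℕ} (x : Fin m → Bool) (y : Fin k → Bool) :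
    HasBalancedFork x y ↔ 0 ≤ relMargin x y := by
  constructor
  · rintro ⟨F, hF⟩
    exact hF.trim_margin_nonneg.trans ((relMargin_isGreatest x y).2 ⟨F.trim, F.trim_closed, rfl⟩)
  · intro h
    obtain ⟨F, -, hF⟩ := (relMargin_isGreatest x y).1
    obtain ⟨t₁, t₂, hs, hm⟩ := (F.margin_isGreatest m).1
    rw [hF, hm, le_min_iff] at h
    exact F.exists_balanced_of_reach_nonneg hs h.1 h.2

/-- This is why the event is expressed through balanced forks: closedness is not preserved when an
honest leaf becomes adversarial. -/
theorem exists_balanced_mono {n m : ℕ} :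
    Monotone fun w : Fin n → Bool => ∃ F : Fork w, F.Balanced m :=
  fun _ _ h ⟨F, hF⟩ => ⟨F.ofLE h, hF⟩

/-! ### Independent bits and stochastic domination. -/

/-- The mean of a function of `n` independent bits that are `true` with probability `p`. -/
def bernoulliMean (p : ℝ) : (n : ℕ) → ((Fin n → Bool) → ℝ) → ℝ
  | 0, g => g Fin.elim0
  | n + 1, g => bernoulliMean p n fun u =>
      p * g (Fin.snoc (α := fun _ => Bool) u true) + (1 - p) * g (Fin.snoc (α := fun _ => Bool) u false)

theorem bernoulliMean_mono {p : ℝ} (h0 : 0 ≤ p) (h1 : p ≤ 1) {n : ℕ} {g g' : (Fin n → Bool) → ℝ}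
    (h : ∀ w, g w ≤ g' w) : bernoulliMean p n g ≤ bernoulliMean p n g' := by
  induction n with
  | zero => exact h _
  | succ n ih =>
    exact ih fun u => add_le_add (mul_le_mul_of_nonneg_left (h _) h0)
      (mul_le_mul_of_nonneg_left (h _) (sub_nonneg.2 h1))

theorem bernoulliMean_const (p : ℝ) (n : ℕ) (c : ℝ) : bernoulliMean p n (fun _ => c) = c := by
  induction n with
  | zero => rfl
  | succ n ih =>
    simp only [bernoulliMean]
    rw [← ih]
    congr 1
    funext u
    rw [ih]
    ring

theorem bernoulliMean_add (p : ℝ) {n : ℕ} (g g' : (Fin n → Bool) → ℝ) :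
    bernoulliMean p n (fun w => g w + g' w) = bernoulliMean p n g + bernoulliMean p n g' := by
  induction n with
  | zero => rfl
  | succ n ih =>
    simp only [bernoulliMean]
    rw [← ih]
    congr 1
    funext u
    ring

theorem bernoulliMean_const_mul (p c : ℝ) {n : ℕ} (g : (Fin n → Bool) → ℝ) :
    bernoulliMean p n (fun w => c * g w) = c * bernoulliMean p n g := by
  induction n with
  | zero => rfl
  | succ n ih =>
    simp only [bernoulliMean]
    rw [← ih]
    congr 1
    funext u
    ring

theorem bernoulliMean_sum (p : ℝ) {n : ℕ} (s : Finset ℕ) (g : ℕ → (Fin n → Bool) → ℝ) :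
    bernoulliMean p n (fun w => ∑ i ∈ s, g i w) = ∑ i ∈ s, bernoulliMean p n (g i) := by
  classical
  induction s using Finset.induction_on with
  | empty => simpa using bernoulliMean_const p n 0
  | insert i s hi ih =>
    simp only [Finset.sum_insert hi]
    rw [bernoulliMean_add, ih]

theorem sum_snoc {n : ℕ} (f : (Fin (n + 1) → Bool) → ℝ) :
    ∑ w, f w = ∑ u : Fin n → Bool, (f (Fin.snoc (α := fun _ => Bool) u true) +
      f (Fin.snoc (α := fun _ => Bool) u false)) := by
  rw [← (Fin.snocEquiv fun _ : Fin (n + 1) => Bool).sum_comp, Fintype.sum_prod_type,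
    Fintype.sum_bool, ← Finset.sum_add_distrib]
  rfl

/-- The mean as a sum over all strings. -/
theorem bernoulliMean_eq_sum (p : ℝ) {n : ℕ} (g : (Fin n → Bool) → ℝ) :
    bernoulliMean p n g = ∑ w, (∏ i, if w i then p else 1 - p) * g w := by
  induction n with
  | zero =>
    rw [Fintype.sum_unique]
    simp only [Finset.univ_eq_empty, Finset.prod_empty, one_mul]
    exact congrArg g (Subsingleton.elim _ _)
  | succ n ih =>
    simp only [bernoulliMean]
    rw [ih, sum_snoc]
    refine Finset.sum_congr rfl fun u _ => ?_
    simp only [Fin.prod_univ_castSucc, Fin.snoc_castSucc, Fin.snoc_last]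
    simp only [if_true, Bool.false_eq_true, if_false]
    ring

theorem init_eq_iff {n : ℕ} (w : Fin (n + 1) → Bool) (u : Fin n → Bool) :
    (fun i => w (Fin.castSucc i)) = u ↔ w = Fin.snoc (α := fun _ => Bool) u true ∨
      w = Fin.snoc (α := fun _ => Bool) u false := by
  constructor
  · rintro rfl
    have h := Fin.snoc_init_self (α := fun _ => Bool) w
    cases hb : w (Fin.last n)
    · right
      rw [hb] at h
      exact h.symm
    · left
      rw [hb] at h
      exact h.symm
  · rintro (rfl | rfl) <;> funext i <;> simp

section Law

variable {Ω : Type*} [MeasurableSpace Ω] (P : Measure Ω) {n : ℕ}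

theorem EpsMartingale.anti {ε ε' : ℝ} (hε : ε' ≤ ε) {W : Ω → Fin n → Bool}
    (h : EpsMartingale P ε W) : EpsMartingale P ε' W :=
  ⟨h.1, fun t u => (h.2 t u).trans (by linarith)⟩

theorem EpsMartingale.init {ε : ℝ} {W : Ω → Fin (n + 1) → Bool} (h : EpsMartingale P ε W) :
    EpsMartingale P ε fun ω (i : Fin n) => W ω (Fin.castSucc i) := by
  refine ⟨measurable_pi_lambda _ fun i => (measurable_pi_apply _).comp h.1, fun t u => ?_⟩
  have := h.2 t.castSucc (Fin.snoc (α := fun _ => Bool) u false)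
  convert this using 4
  ext ω
  constructor
  · intro h i hi
    obtain ⟨j, rfl⟩ := Fin.exists_castSucc_eq.2 (hi.trans_le (Fin.le_last _)).ne
    rw [Fin.snoc_castSucc]
    exact h j hi
  · intro h i hi
    have := h i.castSucc hi
    rwa [Fin.snoc_castSucc] at this

variable [IsProbabilityMeasure P]

theorem real_init {W : Ω → Fin (n + 1) → Bool} (hW : Measurable W) (u : Fin n → Bool) :
    P.real ((fun ω i => W ω (Fin.castSucc i)) ⁻¹' {u}) =
      P.real (W ⁻¹' {Fin.snoc (α := fun _ => Bool) u true}) +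
        P.real (W ⁻¹' {Fin.snoc (α := fun _ => Bool) u false}) := by
  rw [← measureReal_union _ (hW (measurableSet_singleton _))]
  · congr 1
    ext ω
    exact init_eq_iff (W ω) u
  · refine Disjoint.preimage _ (Set.disjoint_singleton.2 fun h => ?_)
    have := congrFun h (Fin.last n)
    simp at this

/-- The martingale condition with its denominator cleared, so that null histories need no exception
later. -/
theorem EpsMartingale.real_snoc_true_le {ε : ℝ} {W : Ω → Fin (n + 1) → Bool}
    (h : EpsMartingale P ε W) (u : Fin n → Bool) :
    P.real (W ⁻¹' {Fin.snoc (α := fun _ => Bool) u true}) ≤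
      (1 - ε) / 2 * P.real ((fun ω i => W ω (Fin.castSucc i)) ⁻¹' {u}) := by
  have h1 := h.2 (Fin.last n) (Fin.snoc (α := fun _ => Bool) u true)
  set S := {ω | ∀ i, i < Fin.last n → W ω i = Fin.snoc (α := fun _ => Bool) u true i} with hS
  have hS' : (fun ω i => W ω (Fin.castSucc i)) ⁻¹' {u} = S := by
    ext ω
    simp only [hS, Set.mem_preimage, Set.mem_singleton_iff, Set.mem_ofPred_eq]
    constructor
    · rintro rfl i hi
      obtain ⟨j, rfl⟩ := Fin.exists_castSucc_eq.2 hi.ne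
      simp
    · intro h
      funext i
      have := h i.castSucc (Fin.castSucc_lt_last i)
      rwa [Fin.snoc_castSucc] at this
  have hSm : MeasurableSet S := by
    rw [← hS']
    exact (measurable_pi_lambda _ fun i => (measurable_pi_apply _).comp h.1)
      (measurableSet_singleton u)
  have hT : W ⁻¹' {Fin.snoc (α := fun _ => Bool) u true} ⊆ S ∩ {ω | W ω (Fin.last n) = true} := by
    intro ω hω
    have hω' : W ω = Fin.snoc (α := fun _ => Bool) u true := hω
    refine ⟨fun i _ => by rw [hω'], ?_⟩
    rw [Set.mem_ofPred_eq, hω']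
    simp
  rw [hS']
  refine (measureReal_mono hT).trans ?_
  rw [measureReal_def, cond_apply hSm, ENNReal.toReal_mul, ENNReal.toReal_inv, ← measureReal_def,
    ← measureReal_def] at h1
  rcases eq_or_lt_of_le (measureReal_nonneg (μ := P) (s := S)) with h0 | h0
  · rw [← h0, mul_zero, h0]
    exact measureReal_mono Set.inter_subset_left
  · rwa [inv_mul_le_iff₀ h0, mul_comm] at h1

/-- Monotone functions of a string with the martingale condition are dominated in mean by those of
independent bits. -/
theorem EpsMartingale.sum_le_bernoulliMean {ε : ℝ} (h0 : -1 ≤ ε) (h1 : ε ≤ 1)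
    {W : Ω → Fin n → Bool}
    (h : EpsMartingale P ε W) {g : (Fin n → Bool) → ℝ} (hg : Monotone g) :
    ∑ w, P.real (W ⁻¹' {w}) * g w ≤ bernoulliMean ((1 - ε) / 2) n g := by
  induction n with
  | zero =>
    rw [Fintype.sum_unique]
    have hu : ∀ v, P.real (W ⁻¹' {v}) = 1 := fun v =>
      (congrArg P.real (Set.eq_univ_of_forall fun ω => Subsingleton.elim _ _)).trans probReal_univ
    rw [hu, one_mul]
    exact (congrArg g (Subsingleton.elim _ _)).le
  | succ n ih =>
    have hsnoc : ∀ {u u' : Fin n → Bool} {b b' : Bool}, u ≤ u' → b ≤ b' →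
        (Fin.snoc (α := fun _ => Bool) u b : Fin (n + 1) → Bool) ≤
          Fin.snoc (α := fun _ => Bool) u' b' := fun {u u' b b'} hu hb i => by
      refine Fin.lastCases ?_ (fun i => ?_) i
      · simpa using hb
      · simpa using hu i
    -- The last bit is averaged out. Its conditional probability of `true` may be raised to `(1 - ε)
    -- / 2` because `g` is larger there, and the averaged function is again monotone.
    refine le_trans ?_ (ih h.init (g := fun u => (1 - ε) / 2 * g (Fin.snoc (α := fun _ => Bool) u true)
      + (1 - (1 - ε) / 2) * g (Fin.snoc (α := fun _ => Bool) u false)) fun u u' hu => ?_)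
    · rw [sum_snoc]
      refine Finset.sum_le_sum fun u _ => ?_
      have h2 := h.real_snoc_true_le P u
      have h3 := real_init P h.1 u
      have h4 := hg (hsnoc (le_refl u) (Bool.false_le true))
      rw [h3] at h2 ⊢
      nlinarith [mul_le_mul_of_nonneg_right h2 (sub_nonneg.2 h4)]
    · exact add_le_add
        (mul_le_mul_of_nonneg_left (hg (hsnoc hu le_rfl)) (by linarith))
        (mul_le_mul_of_nonneg_left (hg (hsnoc hu le_rfl)) (by linarith))

theorem real_preimage_eq_sum {W : Ω → Fin n → Bool} (hW : Measurable W)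
    (U : Set (Fin n → Bool)) :
    P.real (W ⁻¹' U) = ∑ w, P.real (W ⁻¹' {w}) * U.indicator 1 w := by
  classical
  have h := sum_measureReal_preimage_singleton (μ := P) (f := W) U.toFinset
    fun y _ => hW (measurableSet_singleton y)
  rw [Set.coe_toFinset] at h
  rw [← h]
  simp only [Set.indicator_apply, Pi.one_apply, mul_ite, mul_one, mul_zero]
  rw [← Finset.sum_filter]
  congr 1
  ext w
  simp

theorem EpsMartingale.real_preimage_le {ε : ℝ} (h0 : -1 ≤ ε) (h1 : ε ≤ 1) {W : Ω → Fin n → Bool}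
    (h : EpsMartingale P ε W) {U : Set (Fin n → Bool)} (hU : IsUpperSet U) :
    P.real (W ⁻¹' U) ≤ bernoulliMean ((1 - ε) / 2) n (U.indicator 1) := by
  rw [real_preimage_eq_sum P h.1]
  refine h.sum_le_bernoulliMean P h0 h1 fun w w' hw => ?_
  by_cases hm : w ∈ U
  · rw [Set.indicator_of_mem hm, Set.indicator_of_mem (hU hw hm)]
    simp
  · rw [Set.indicator_of_notMem hm]
    exact Set.indicator_nonneg (fun _ _ => zero_le_one) _

theorem IsBernoulliString.real_singleton {ε : ℝ} {B : Ω → Fin n → Bool}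
    (h : IsBernoulliString P ε B) (w : Fin n → Bool) :
    P.real (B ⁻¹' {w}) = ∏ i, if w i then (1 - ε) / 2 else 1 - (1 - ε) / 2 := by
  obtain ⟨hm, hi, hp⟩ := h
  have hB : B ⁻¹' {w} = ⋂ i ∈ Finset.univ, (fun ω => B ω i) ⁻¹' {w i} := by
    ext ω
    simp [funext_iff]
  have hmeas : ∀ i b, MeasurableSet ((fun ω => B ω i) ⁻¹' {b}) := fun i b =>
    ((measurable_pi_apply i).comp hm) (measurableSet_singleton b)
  have := hi.measure_inter_preimage_eq_mul Finset.univ (sets := fun i => {w i})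
    fun i _ => measurableSet_singleton _
  rw [measureReal_def, hB, this, ENNReal.toReal_prod]
  refine Finset.prod_congr rfl fun i _ => ?_
  have ht : P.real ((fun ω => B ω i) ⁻¹' {true}) = (1 - ε) / 2 := hp i
  cases hb : w i
  · have hc : (fun ω => B ω i) ⁻¹' {false} = ((fun ω => B ω i) ⁻¹' {true})ᶜ := by
      ext ω
      simp
    rw [← measureReal_def, hc, probReal_compl_eq_one_sub (hmeas i true), ht]
    simp
  · rw [← measureReal_def, ht]
    simp

theorem real_append_preimage {ε : ℝ} {m k : ℕ} {x : Ω → Fin m → Bool} {y : Ω → Fin k → Bool}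
    (hx : IsBernoulliString P ε x) (hy : IsBernoulliString P ε y) (hxy : IndepFun x y P)
    (U : Set (Fin (m + k) → Bool)) :
    P.real ((fun ω => Fin.append (x ω) (y ω)) ⁻¹' U) =
      bernoulliMean ((1 - ε) / 2) (m + k) (U.indicator 1) := by
  have hm : Measurable fun ω => Fin.append (x ω) (y ω) := by
    refine measurable_pi_lambda _ fun i => ?_
    refine Fin.addCases (fun i => ?_) (fun i => ?_) i
    · simp only [Fin.append_left]
      exact (measurable_pi_apply i).comp hx.1
    · simp only [Fin.append_right]
      exact (measurable_pi_apply i).comp hy.1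
  rw [real_preimage_eq_sum P hm, bernoulliMean_eq_sum]
  refine Finset.sum_congr rfl fun w _ => ?_
  congr 1
  have hw : (fun ω => Fin.append (x ω) (y ω)) ⁻¹' {w} =
      x ⁻¹' {fun i => w (Fin.castAdd k i)} ∩ y ⁻¹' {fun i => w (Fin.natAdd m i)} := by
    ext ω
    simp only [Set.mem_preimage, Set.mem_singleton_iff, Set.mem_inter_iff]
    constructor
    · rintro rfl
      simp
    · rintro ⟨h1, h2⟩
      rw [h1, h2]
      exact Fin.append_castAdd_natAdd
  rw [hw, measureReal_def, hxy.measure_inter_preimage_eq_mul _ _ (measurableSet_singleton _)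
    (measurableSet_singleton _), ENNReal.toReal_mul, ← measureReal_def, ← measureReal_def,
    hx.real_singleton P, hy.real_singleton P, Fin.prod_univ_add]

end Law

/-! ### Reach and margin of independent bits as a random walk. -/

theorem padBits_snoc_of_lt {n : ℕ} (u : Fin n → Bool) (b : Bool) {i : ℕ} (hi : i < n) :
    padBits (Fin.snoc (α := fun _ => Bool) u b : Fin (n + 1) → Bool) i = padBits u i := by
  unfold padBits
  rw [dif_pos (by omega), dif_pos hi]
  exact Fin.snoc_castSucc (α := fun _ => Bool) b u ⟨i, hi⟩

theorem padBits_snoc_self {n : ℕ} (u : Fin n → Bool) (b : Bool) :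
    padBits (Fin.snoc (α := fun _ => Bool) u b : Fin (n + 1) → Bool) n = b := by
  unfold padBits
  rw [dif_pos (by omega)]
  exact Fin.snoc_last (α := fun _ => Bool) b u

theorem reachSeq_snoc {n : ℕ} (u : Fin n → Bool) (b : Bool) :
    reachSeq (padBits (Fin.snoc (α := fun _ => Bool) u b : Fin (n + 1) → Bool)) (n + 1) =
      reachStep (reachSeq (padBits u) n) b := by
  simp only [reachSeq]
  rw [padBits_snoc_self, reachSeq_congr fun i hi => padBits_snoc_of_lt u b hi]

theorem marginSeq_snoc {m n : ℕ} (hm : m ≤ n) (u : Fin n → Bool) (b : Bool) :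
    marginSeq (padBits (Fin.snoc (α := fun _ => Bool) u b : Fin (n + 1) → Bool)) m (n + 1) =
      marginStep (reachSeq (padBits u) n) (marginSeq (padBits u) m n) b := by
  rw [marginSeq_succ _ hm, padBits_snoc_self,
    reachSeq_congr fun i hi => padBits_snoc_of_lt u b hi,
    marginSeq_congr m fun i hi => padBits_snoc_of_lt u b hi]

theorem reachSeq_le (b : ℕ → Bool) (t : ℕ) : reachSeq b t ≤ t := by
  induction t with
  | zero => exact le_rfl
  | succ t ih =>
    simp only [reachSeq, reachStep]
    push_cast
    split_ifs <;> omega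

section Walk

variable {p β : ℝ}

/-- The reach of a random string is dominated by a geometric distribution. -/
theorem bernoulliMean_reach_tail (h0 : 0 ≤ p) (h1 : p ≤ 1) (hβ : 0 ≤ β) (hp : p = β * (1 - p))
    (n r : ℕ) : bernoulliMean p n
      (fun w => if (r : ℤ) ≤ reachSeq (padBits w) n then (1 : ℝ) else 0) ≤ β ^ r := by
  induction n generalizing r with
  | zero =>
    change (if (r : ℤ) ≤ reachSeq (padBits (Fin.elim0 : Fin 0 → Bool)) 0 then (1 : ℝ) else 0) ≤ _
    cases r with
    | zero => simp [reachSeq]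
    | succ r =>
      rw [if_neg (by change ¬ ((r + 1 : ℕ) : ℤ) ≤ 0; omega)]
      positivity
  | succ n ih =>
    cases r with
    | zero =>
      rw [pow_zero]
      refine (bernoulliMean_mono h0 h1 (g' := fun _ => 1) fun w => ?_).trans
        (bernoulliMean_const p _ 1).le
      split_ifs <;> norm_num
    | succ r =>
      -- Levels of at least 1 do not see the floor at 0, so the walk behaves there as a free one.
      have hstep : ∀ u : Fin n → Bool, p * (if ((r + 1 : ℕ) : ℤ) ≤ reachSeq (padBits
            (Fin.snoc (α := fun _ => Bool) u true : Fin (n + 1) → Bool)) (n + 1) then (1 : ℝ) else 0)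
          + (1 - p) * (if ((r + 1 : ℕ) : ℤ) ≤ reachSeq (padBits
            (Fin.snoc (α := fun _ => Bool) u false : Fin (n + 1) → Bool)) (n + 1) then (1 : ℝ) else 0)
          = p * (if ((r : ℕ) : ℤ) ≤ reachSeq (padBits u) n then (1 : ℝ) else 0)
          + (1 - p) * (if ((r + 2 : ℕ) : ℤ) ≤ reachSeq (padBits u) n then (1 : ℝ) else 0) := fun u => by
        rw [reachSeq_snoc, reachSeq_snoc]
        simp only [reachStep, if_true, Bool.false_eq_true, if_false]
        congr 2
        · exact if_congr (by push_cast; omega) rfl rfl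
        · exact if_congr (by push_cast; omega) rfl rfl
      simp only [bernoulliMean]
      simp only [hstep]
      rw [bernoulliMean_add, bernoulliMean_const_mul, bernoulliMean_const_mul]
      calc _ ≤ p * β ^ r + (1 - p) * β ^ (r + 2) :=
            add_le_add (mul_le_mul_of_nonneg_left (ih r) h0)
              (mul_le_mul_of_nonneg_left (ih (r + 2)) (by linarith))
        _ = β ^ (r + 1) := by
            -- The ratio β is a fixed point of the one-step tail recursion.
            have h2 : p + (1 - p) * β ^ 2 = β := by linear_combination (1 - β) * hp
            rw [pow_add, pow_succ]
            linear_combination β ^ r * h2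

/-- Summation by parts, z^R = 1 + (z - 1) ∑_{i<R} z^i, turns the geometric tail into an exponential
moment bounded uniformly in n. -/
theorem bernoulliMean_pow_reach_le (h0 : 0 ≤ p) (h1 : p ≤ 1) (hβ : 0 ≤ β) (hp : p = β * (1 - p))
    {z : ℝ} (hz : 1 ≤ z) (hzβ : z * β < 1) (n : ℕ) :
    bernoulliMean p n (fun w => z ^ (reachSeq (padBits w) n).toNat) ≤
      1 + (z - 1) * β / (1 - z * β) := by
  have hexp : ∀ w : Fin n → Bool, z ^ (reachSeq (padBits w) n).toNat =
      1 + (z - 1) * ∑ i ∈ Finset.range n, z ^ i *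
        (if ((i + 1 : ℕ) : ℤ) ≤ reachSeq (padBits w) n then (1 : ℝ) else 0) := fun w => by
    have hle := reachSeq_le (padBits w) n
    have hnn := reachSeq_nonneg (padBits w) n
    have hf : (Finset.range n).filter (fun i : ℕ => ((i + 1 : ℕ) : ℤ) ≤ reachSeq (padBits w) n) =
        Finset.range (reachSeq (padBits w) n).toNat := by
      ext i
      simp only [Finset.mem_filter, Finset.mem_range]
      omega
    simp only [mul_ite, mul_one, mul_zero]
    rw [← Finset.sum_filter, hf, mul_geom_sum]
    ring
  simp only [hexp]
  rw [bernoulliMean_add, bernoulliMean_const, bernoulliMean_const_mul, bernoulliMean_sum]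
  have hsum : ∑ i ∈ Finset.range n, bernoulliMean p n (fun w => z ^ i *
      (if ((i + 1 : ℕ) : ℤ) ≤ reachSeq (padBits w) n then (1 : ℝ) else 0)) ≤ β / (1 - z * β) := by
    calc _ ≤ ∑ i ∈ Finset.range n, β * (z * β) ^ i := by
          refine Finset.sum_le_sum fun i _ => ?_
          rw [bernoulliMean_const_mul]
          refine (mul_le_mul_of_nonneg_left (bernoulliMean_reach_tail h0 h1 hβ hp n (i + 1))
            (by positivity)).trans_eq ?_
          ring
      _ = β * ∑ i ∈ Finset.range n, (z * β) ^ i := (Finset.mul_sum _ _ _).symm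
      _ ≤ β / (1 - z * β) := by
          rw [le_div_iff₀ (by linarith), mul_assoc]
          have h2 := mul_neg_geom_sum (z * β) n
          have h3 : 0 ≤ (z * β) ^ n := by positivity
          rw [mul_comm (∑ i ∈ Finset.range n, (z * β) ^ i), h2]
          nlinarith
  rw [mul_div_assoc]
  have := mul_le_mul_of_nonneg_left hsum (sub_nonneg.2 hz)
  linarith

/-- The potential at margin `-a` and reach `d - a`. -/
noncomputable def negPotential (β z : ℝ) (a d : ℕ) : ℝ :=
  (β * z) ^ a * z ^ d + (z - 1) / (z * (1 - β * z ^ 3)) * z⁻¹ ^ a * (β * z ^ 3) ^ (d + 1)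

/-- A function of reach and margin that contracts in mean under the recurrence and is at least `1`
when the margin is nonnegative. -/
noncomputable def potential (β z : ℝ) (r μ : ℤ) : ℝ :=
  if 0 ≤ μ then z ^ r.toNat else negPotential β z (-μ).toNat (r - μ).toNat

variable {z : ℝ}

/-- Away from the floor, reach and margin move together, so d is constant. In a, both (βz)^a and
z^(-a) are eigenfunctions of the walk with eigenvalue pz + (1 - p)/z. -/
theorem negPotential_harmonic (hz : 0 < z) (hp : p = β * (1 - p)) (a d : ℕ) :
    p * negPotential β z a d + (1 - p) * negPotential β z (a + 2) d =
      (p * z + (1 - p) / z) * negPotential β z (a + 1) d := by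
  unfold negPotential
  generalize hs : 1 - p = s at hp
  generalize (z - 1) / (z * (1 - β * z ^ 3)) = κ
  generalize (β * z ^ 3) ^ (d + 1) = A
  subst hp
  rw [pow_add (β * z) a 2, pow_succ (β * z) a, pow_add z⁻¹ a 2, pow_succ z⁻¹ a]
  field_simp
  ring

/-- The boundary condition at reach 0, where a `0` lowers the margin alone and d grows by one: the
potential behaves as if d had stayed fixed. The coefficient of the second term in `negPotential` is
determined by this identity. -/
theorem negPotential_shift (hz : 0 < z) (hz3 : β * z ^ 3 < 1) (a : ℕ) :
    negPotential β z (a + 1) (a + 1) = negPotential β z (a + 1) a := by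
  unfold negPotential
  have h1 : 1 - β * z ^ 3 ≠ 0 := by linarith
  rw [pow_succ (β * z ^ 3) (a + 1), pow_succ z a, inv_pow]
  have h2 : (β * z ^ 3) ^ (a + 1) = (β * z) ^ (a + 1) * (z ^ (a + 1) * z ^ (a + 1)) := by
    rw [← mul_pow, ← mul_pow]
    congr 1
    ring
  rw [h2, pow_succ z a]
  have h3 : z ^ a ≠ 0 := by positivity
  have h4 : (z - 1) / (z * (1 - β * z ^ 3)) * (1 - β * z ^ 3) * z = z - 1 := by
    rw [mul_assoc, mul_comm (1 - β * z ^ 3) z, div_mul_cancel₀ _ (mul_ne_zero hz.ne' h1)]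
  have h5 := inv_mul_cancel₀ (mul_ne_zero h3 hz.ne')
  generalize (β * z) ^ (a + 1) = B
  generalize (z - 1) / (z * (1 - β * z ^ 3)) = κ at *
  generalize z ^ a = D at *
  generalize (D * z)⁻¹ = i at *
  linear_combination (-B * D) * h4 - κ * B * D * z * (1 - β * z ^ 3) * h5

theorem negPotential_nonneg (hz : 1 ≤ z) (hβ : 0 ≤ β) (hz3 : β * z ^ 3 < 1) (a d : ℕ) :
    0 ≤ negPotential β z a d := by
  have h1 : 0 ≤ z - 1 := by linarith
  have h2 : 0 < 1 - β * z ^ 3 := by linarith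
  unfold negPotential
  positivity

/-- When the margin returns from -1 to 0, the potential can only drop below the continued harmonic
branch. -/
theorem pow_le_negPotential_zero (hz : 1 ≤ z) (hβ : 0 ≤ β) (hz3 : β * z ^ 3 < 1) (d : ℕ) :
    z ^ d ≤ negPotential β z 0 d := by
  have h1 : 0 ≤ z - 1 := by linarith
  have h2 : 0 < 1 - β * z ^ 3 := by linarith
  unfold negPotential
  rw [pow_zero, one_mul]
  exact le_add_of_nonneg_right (by positivity)

theorem potential_of_nonneg (r : ℕ) {μ : ℤ} (h : 0 ≤ μ) : potential β z r μ = z ^ r := by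
  unfold potential
  rw [if_pos h, Int.toNat_natCast]

theorem potential_of_neg (r a : ℕ) {r' μ : ℤ} (hr : r' = r) (h : μ = -((a : ℤ) + 1)) :
    potential β z r' μ = negPotential β z (a + 1) (r + (a + 1)) := by
  unfold potential
  rw [if_neg (by omega)]
  congr 1 <;> omega

/-- For negative margin this is harmonicity with the two boundary facts. For nonnegative margin and
positive reach the margin stays nonnegative and z^r gives equality. The margin can first become
negative only at r = μ = 0, which is where `hzβ` enters. -/
theorem potential_step_le (h0 : 0 ≤ p) (h1 : p ≤ 1) (hβ : 0 ≤ β) (hp : p = β * (1 - p))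
    (hz : 1 ≤ z) (hz3 : β * z ^ 3 < 1) (hzβ : negPotential β z 1 1 ≤ z⁻¹) {r μ : ℤ} (hr : 0 ≤ r)
    (hμ : μ ≤ r) :
    p * potential β z (reachStep r true) (marginStep r μ true) +
      (1 - p) * potential β z (reachStep r false) (marginStep r μ false) ≤
        (p * z + (1 - p) / z) * potential β z r μ := by
  have hz0 : 0 < z := by linarith
  lift r to ℕ using hr
  simp only [reachStep, marginStep, if_true, Bool.false_eq_true, if_false]
  rcases lt_or_ge μ 0 with hneg | hpos
  · obtain ⟨a, rfl⟩ : ∃ a : ℕ, μ = -((a : ℤ) + 1) := ⟨(-μ - 1).toNat, by omega⟩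
    rw [if_neg (by omega), potential_of_neg r a rfl rfl]
    have hup : potential β z ((r : ℤ) + 1) (-((a : ℤ) + 1) + 1) ≤
        negPotential β z a (r + (a + 1)) := by
      cases a with
      | zero =>
        have := potential_of_nonneg (β := β) (z := z) (r + 1) (μ := -(((0 : ℕ) : ℤ) + 1) + 1)
          (by norm_num)
        push_cast at this ⊢
        rw [this]
        exact pow_le_negPotential_zero hz hβ hz3 _
      | succ a =>
        rw [potential_of_neg (r + 1) a (by push_cast; ring) (by push_cast; ring)]
        exact le_of_eq (congrArg _ (by ring))
    have hdown : potential β z (max ((r : ℤ) - 1) 0) (-((a : ℤ) + 1) - 1) =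
        negPotential β z (a + 2) (r + (a + 1)) := by
      cases r with
      | zero =>
        rw [potential_of_neg 0 (a + 1) (by simp) (by push_cast; ring), zero_add, zero_add]
        exact negPotential_shift hz0 hz3 (a + 1)
      | succ r =>
        rw [potential_of_neg r (a + 1) (by push_cast; omega) (by push_cast; ring)]
        exact congrArg _ (by ring)
    rw [hdown, ← negPotential_harmonic hz0 hp]
    exact add_le_add (mul_le_mul_of_nonneg_left hup h0) le_rfl
  · have hup := potential_of_nonneg (β := β) (z := z) (r + 1) (μ := μ + 1) (by omega)
    push_cast at hup
    rw [hup, potential_of_nonneg r hpos]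
    cases r with
    | zero =>
      have : μ = 0 := by push_cast at hμ; omega
      subst this
      rw [if_neg (by simp), potential_of_neg 0 0 (by simp) (by simp)]
      rw [div_eq_mul_inv, pow_zero, mul_one, zero_add, pow_one]
      exact add_le_add le_rfl (mul_le_mul_of_nonneg_left hzβ (by linarith))
    | succ r =>
      have hmax : max (((r + 1 : ℕ) : ℤ) - 1) 0 = (r : ℕ) := by push_cast; omega
      rw [hmax, potential_of_nonneg r (by split_ifs <;> omega)]
      apply le_of_eq
      rw [pow_succ, pow_succ]
      field_simp

theorem bernoulliMean_potential_le (h0 : 0 ≤ p) (h1 : p ≤ 1) (hβ : 0 ≤ β) (hp : p = β * (1 - p))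
    (hz : 1 ≤ z) (hz3 : β * z ^ 3 < 1) (hzβ : negPotential β z 1 1 ≤ z⁻¹) (m k : ℕ) :
    bernoulliMean p (m + k) (fun w => potential β z (reachSeq (padBits w) (m + k))
      (marginSeq (padBits w) m (m + k))) ≤ (p * z + (1 - p) / z) ^ k *
        bernoulliMean p m (fun w => z ^ (reachSeq (padBits w) m).toNat) := by
  induction k with
  | zero =>
    rw [pow_zero, one_mul]
    refine bernoulliMean_mono h0 h1 fun w => le_of_eq ?_
    rw [marginSeq_eq_reachSeq _ (Nat.add_zero m).le]
    exact if_pos (reachSeq_nonneg _ _)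
  | succ k ih =>
    have hθ : 0 ≤ p * z + (1 - p) / z := by
      have : 0 ≤ 1 - p := by linarith
      positivity
    rw [pow_succ', mul_assoc]
    refine le_trans ?_ (mul_le_mul_of_nonneg_left ih hθ)
    rw [← bernoulliMean_const_mul]
    change bernoulliMean p (m + k) _ ≤ _
    refine bernoulliMean_mono h0 h1 fun u => ?_
    let s b := padBits (n := m + k + 1) (Fin.snoc (α := fun _ => Bool) u b)
    change p * potential β z (reachSeq (s true) (m + k + 1)) (marginSeq (s true) m (m + k + 1)) +
      (1 - p) * potential β z (reachSeq (s false) (m + k + 1))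
        (marginSeq (s false) m (m + k + 1)) ≤ _
    simp only [s]
    rw [reachSeq_snoc, reachSeq_snoc, marginSeq_snoc (Nat.le_add_right m k),
      marginSeq_snoc (Nat.le_add_right m k)]
    exact potential_step_le h0 h1 hβ hp hz hz3 hzβ (reachSeq_nonneg _ _)
      (marginSeq_le_reachSeq _ _ _)

/-- The probability that the margin of independent bits is nonnegative. -/
noncomputable def marginProb (p : ℝ) (m k : ℕ) : ℝ :=
  bernoulliMean p (m + k) fun w => if 0 ≤ marginSeq (padBits w) m (m + k) then 1 else 0

/-- Markov's inequality: the potential dominates the indicator of nonnegative margin. -/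
theorem marginProb_le_pow (h0 : 0 ≤ p) (h1 : p ≤ 1) (hβ : 0 ≤ β) (hp : p = β * (1 - p))
    (hz : 1 ≤ z) (hz3 : β * z ^ 3 < 1) (hzβ : negPotential β z 1 1 ≤ z⁻¹) (m k : ℕ) :
    marginProb p m k ≤ (p * z + (1 - p) / z) ^ k * (1 + (z - 1) * β / (1 - z * β)) := by
  have hθ : 0 ≤ p * z + (1 - p) / z := by
    have : 0 ≤ 1 - p := by linarith
    positivity
  have h2 : z * β < 1 := by nlinarith [mul_nonneg hβ (sub_nonneg.2 hz), sq_nonneg z]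
  refine le_trans (bernoulliMean_mono h0 h1 fun w => ?_)
    ((bernoulliMean_potential_le h0 h1 hβ hp hz hz3 hzβ m k).trans
      (mul_le_mul_of_nonneg_left (bernoulliMean_pow_reach_le h0 h1 hβ hp hz h2 m) (by positivity)))
  unfold potential
  split_ifs
  · exact one_le_pow₀ hz
  · exact negPotential_nonneg hz hβ hz3 _ _

/-- Either the last bit is `1`, or it is `0` and the reach before it was positive, an event of
probability at most β; and p + (1 - p)β = 2p. -/
theorem marginProb_le_two_mul (h0 : 0 ≤ p) (h1 : p ≤ 1) (hβ : 0 ≤ β) (hp : p = β * (1 - p))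
    (m k : ℕ) : marginProb p m (k + 1) ≤ 2 * p := by
  refine le_trans (b := bernoulliMean p (m + k) fun u => p + (1 - p) *
    if ((1 : ℕ) : ℤ) ≤ reachSeq (padBits u) (m + k) then (1 : ℝ) else 0) ?_ ?_
  · unfold marginProb
    change bernoulliMean p (m + k) _ ≤ _
    refine bernoulliMean_mono h0 h1 fun u => ?_
    change p * (if 0 ≤ marginSeq _ m (m + k + 1) then (1 : ℝ) else 0) +
      (1 - p) * (if 0 ≤ marginSeq _ m (m + k + 1) then (1 : ℝ) else 0) ≤ _
    rw [marginSeq_snoc (Nat.le_add_right m k), marginSeq_snoc (Nat.le_add_right m k)]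
    have hq : 0 ≤ 1 - p := by linarith
    refine add_le_add ?_ (mul_le_mul_of_nonneg_left ?_ hq)
    · exact mul_le_of_le_one_right h0 (by split_ifs <;> norm_num)
    · simp only [marginStep, Bool.false_eq_true, if_false]
      have := marginSeq_le_reachSeq (padBits u) m (m + k)
      split_ifs <;> first | (exfalso; omega) | norm_num
  · rw [bernoulliMean_add, bernoulliMean_const, bernoulliMean_const_mul]
    have := bernoulliMean_reach_tail h0 h1 hβ hp (m + k) 1
    rw [pow_one] at this
    nlinarith [mul_le_mul_of_nonneg_left this (sub_nonneg.2 h1)]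

end Walk

/-! ### The explicit rate and the theorem. -/

theorem marginProb_le_exp {ε : ℝ} (h0 : 0 < ε) (h1 : ε ≤ 1 / 3) (m k : ℕ) :
    marginProb ((1 - ε) / 2) m k ≤ Real.exp (-(ε ^ 3 * (1 - 3 * ε) * k / 2)) := by
  have hp0 : 0 ≤ (1 - ε) / 2 := by linarith
  have hp1 : (1 - ε) / 2 ≤ 1 := by linarith
  have hε1 : 0 < 1 + ε := by linarith
  have hβ : 0 ≤ (1 - ε) / (1 + ε) := div_nonneg (by linarith) hε1.le
  have hp : (1 - ε) / 2 = (1 - ε) / (1 + ε) * (1 - (1 - ε) / 2) := by field_simp; ring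
  cases k with
  | zero =>
    refine (bernoulliMean_mono hp0 hp1 (g' := fun _ => 1) fun w => ?_).trans
      ((bernoulliMean_const _ _ 1).trans_le (by simp))
    split_ifs <;> norm_num
  | succ k =>
    -- The target has no prefactor. For short strings it is at least 1 - ε = 2p; for long ones the
    -- surplus in the rate pays for the factor exp(ε/2) below.
    rcases le_total (ε ^ 2 * ((k + 1 : ℕ) : ℝ)) 2 with hk | hk
    · refine (marginProb_le_two_mul hp0 hp1 hβ hp m k).trans ?_
      refine le_trans ?_ (Real.add_one_le_exp _)
      have h2 : ε * (ε ^ 2 * ((k + 1 : ℕ) : ℝ)) ≤ ε * 2 := mul_le_mul_of_nonneg_left hk h0.le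
      have h3 : 0 ≤ ε ^ 4 * ((k + 1 : ℕ) : ℝ) := by positivity
      nlinarith
    · set z : ℝ := 1 + ε ^ 2 with hzdef
      have hz : 1 ≤ z := by have := sq_nonneg ε; linarith
      have hz0 : 0 < z := by linarith
      have hzpoly : (1 - ε) * (1 + ε) * z ^ 3 ≤ 1 + ε := by
        have h2 : (1 - ε ^ 2) * z ≤ 1 := by rw [hzdef]; nlinarith [sq_nonneg (ε ^ 2)]
        have h3 : z ^ 2 ≤ 1 + ε := by 
          have h4 : 0 ≤ 1 / 9 - ε ^ 2 := by nlinarith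
          rw [hzdef]
          nlinarith [mul_nonneg (sq_nonneg ε) h4]
        calc (1 - ε) * (1 + ε) * z ^ 3 = ((1 - ε ^ 2) * z) * z ^ 2 := by ring
          _ ≤ 1 * z ^ 2 := mul_le_mul_of_nonneg_right h2 (sq_nonneg z)
          _ ≤ 1 + ε := by linarith
      set β : ℝ := (1 - ε) / (1 + ε) with hβdef
      have hβ1 : β * (1 + ε) = 1 - ε := by rw [hβdef]; field_simp
      -- Equivalent to (1 - ε)z³ ≤ 1. Since z - 1 = ε², the second term of the potential involves
      -- the square of the left side, and this bound yields `hneg`.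
      have hkey : ε * β * z ^ 3 ≤ 1 - β * z ^ 3 := by
        have : (1 + ε) * (β * z ^ 3) ≤ 1 := by
          have h2 : (1 + ε) * ((1 + ε) * (β * z ^ 3)) ≤ (1 + ε) * 1 := by
            rw [show (1 + ε) * ((1 + ε) * (β * z ^ 3)) = (β * (1 + ε)) * (1 + ε) * z ^ 3 by ring,
              hβ1]
            linarith
          exact le_of_mul_le_mul_left h2 hε1
        linarith
      have hβpos : 0 < β := div_pos (by linarith) hε1
      have hz3 : β * z ^ 3 < 1 := by
        have : 0 < ε * β * z ^ 3 := by positivity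
        linarith
      have hneg : negPotential β z 1 1 ≤ z⁻¹ := by
        have hd : 0 < 1 - β * z ^ 3 := by linarith
        unfold negPotential
        rw [show z - 1 = ε ^ 2 by rw [hzdef]; ring]
        have hfrac : ε ^ 2 / (z * (1 - β * z ^ 3)) * z⁻¹ ^ 1 * (β * z ^ 3) ^ (1 + 1) ≤
            (1 - β * z ^ 3) / z := by
          rw [show ε ^ 2 / (z * (1 - β * z ^ 3)) * z⁻¹ ^ 1 * (β * z ^ 3) ^ (1 + 1) =
            (ε * β * z ^ 3) ^ 2 / (1 - β * z ^ 3) / z / z by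
              field_simp
              ring]
          have h2 : (ε * β * z ^ 3) ^ 2 / (1 - β * z ^ 3) ≤ 1 - β * z ^ 3 := by
            rw [div_le_iff₀ hd, ← sq]
            exact pow_le_pow_left₀ (by positivity) hkey 2
          exact (div_le_self (by positivity) hz).trans (by gcongr)
        calc _ ≤ (β * z) ^ 1 * z ^ 1 + (1 - β * z ^ 3) / z := by linarith
          _ = z⁻¹ := by field_simp; ring
      refine (marginProb_le_pow hp0 hp1 hβ hp hz hz3 hneg m (k + 1)).trans ?_
      -- To leading order 1 - zβ is 2ε, which makes the fraction about ε/2.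
      have hA : 1 + (z - 1) * β / (1 - z * β) ≤ Real.exp (ε / 2) := by
        refine le_trans ?_ (Real.add_one_le_exp _)
        have h2 : 0 < 1 - z * β := by nlinarith [mul_nonneg hβ (sub_nonneg.2 hz), sq_nonneg z]
        rw [add_comm, add_le_add_iff_right, div_le_iff₀ h2]
        refine le_of_mul_le_mul_left ?_ hε1
        rw [show (1 + ε) * ((z - 1) * β) = (z - 1) * (β * (1 + ε)) by ring,
          show (1 + ε) * (ε / 2 * (1 - z * β)) = ε / 2 * ((1 + ε) - z * (β * (1 + ε))) by ring, hβ1,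
          hzdef]
        nlinarith [pow_pos h0 2, pow_pos h0 3, pow_pos h0 4]
      have hθ : (1 - ε) / 2 * z + (1 - (1 - ε) / 2) / z ≤ Real.exp (-(ε ^ 3 * (1 - ε))) := by
        refine le_trans ?_ (Real.add_one_le_exp _)
        rw [← le_sub_iff_add_le', div_le_iff₀ hz0, hzdef]
        nlinarith [pow_pos h0 4, pow_pos h0 5, pow_pos h0 6, mul_pos h0 h0, pow_pos h0 3]
      have hθ0 : 0 ≤ (1 - ε) / 2 * z + (1 - (1 - ε) / 2) / z := by
        have : 0 ≤ 1 - (1 - ε) / 2 := by linarith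
        positivity
      have hA0 : 0 ≤ 1 + (z - 1) * β / (1 - z * β) := by
        have h2 : 0 ≤ 1 - z * β := by nlinarith [mul_nonneg hβ (sub_nonneg.2 hz), sq_nonneg z]
        have h3 : 0 ≤ z - 1 := by linarith
        positivity
      calc _ ≤ Real.exp (-(ε ^ 3 * (1 - ε))) ^ (k + 1) * Real.exp (ε / 2) :=
            mul_le_mul (pow_le_pow_left₀ hθ0 hθ _) hA hA0 (by positivity)
        _ = Real.exp (((k + 1 : ℕ) : ℝ) * (-(ε ^ 3 * (1 - ε))) + ε / 2) := by
            rw [← Real.exp_nat_mul, ← Real.exp_add]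
        _ ≤ _ := by
            rw [Real.exp_le_exp]
            have h2 : ε * 2 ≤ ε * (ε ^ 2 * ((k + 1 : ℕ) : ℝ)) := mul_le_mul_of_nonneg_left hk h0.le
            have h3 : 0 ≤ ε ^ 4 * ((k + 1 : ℕ) : ℝ) := by positivity
            nlinarith

theorem setOf_relMargin_nonneg {Ω : Type*} {m k : ℕ} (x : Ω → Fin m → Bool) (y : Ω → Fin k → Bool) :
    {ω | 0 ≤ relMargin (x ω) (y ω)} = (fun ω => Fin.append (x ω) (y ω)) ⁻¹'
      {w | ∃ F : Fork w, F.Balanced m} := by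
  ext ω
  exact (hasBalancedFork_iff (x ω) (y ω)).symm

theorem bernoulliMean_balanced_le {p : ℝ} (h0 : 0 ≤ p) (h1 : p ≤ 1) (m k : ℕ) :
    bernoulliMean p (m + k) (Set.indicator {w | ∃ F : Fork w, F.Balanced m} 1) ≤
      marginProb p m k := by
  refine bernoulliMean_mono h0 h1 fun w => ?_
  by_cases hw : ∃ F : Fork w, F.Balanced m
  · rw [Set.indicator_of_mem (show w ∈ {w | ∃ F : Fork w, F.Balanced m} from hw)]
    obtain ⟨F, hF⟩ := hw
    rw [if_pos (hF.marginSeq_nonneg (Nat.le_add_right m k))]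
    rfl
  · rw [Set.indicator_of_notMem (show w ∉ {w | ∃ F : Fork w, F.Balanced m} from hw)]
    split_ifs <;> norm_num

theorem EpsMartingale.real_relMargin_le {Ω : Type*} [MeasurableSpace Ω] (P : Measure Ω)
    [IsProbabilityMeasure P] {ε : ℝ} (h0 : -1 ≤ ε) (h1 : ε ≤ 1) {m k : ℕ}
    {x : Ω → Fin m → Bool} {y : Ω → Fin k → Bool}
    (h : EpsMartingale P ε (fun ω => Fin.append (x ω) (y ω))) :
    P.real {ω | 0 ≤ relMargin (x ω) (y ω)} ≤ bernoulliMean ((1 - ε) / 2) (m + k)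
      (Set.indicator {w | ∃ F : Fork w, F.Balanced m} 1) := by
  rw [setOf_relMargin_nonneg]
  exact h.real_preimage_le P h0 h1 fun _ _ hw => exists_balanced_mono hw

theorem mainTheorem5 :
    (∃ C : ℝ, 0 < C ∧
      ∀ ε : ℝ, 0 < ε → ε < 1 → ∀ (m k : ℕ)
        (Ω : Type*) [MeasurableSpace Ω] (P : Measure Ω) [IsProbabilityMeasure P]
        (x : Ω → Fin m → Bool) (y : Ω → Fin k → Bool)
        (Ω' : Type*) [MeasurableSpace Ω'] (P' : Measure Ω') [IsProbabilityMeasure P']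
        (x' : Ω' → Fin m → Bool) (y' : Ω' → Fin k → Bool),
        EpsMartingale P ε (fun ω => Fin.append (x ω) (y ω)) →
        IsBernoulliString P' ε x' → IsBernoulliString P' ε y' → IndepFun x' y' P' →
        P.real {ω | 0 ≤ relMargin (x ω) (y ω)} ≤ P'.real {ω | 0 ≤ relMargin (x' ω) (y' ω)} ∧
        P'.real {ω | 0 ≤ relMargin (x' ω) (y' ω)}
          ≤ Real.exp (-(ε ^ 3 * (1 - C * ε) * (k : ℝ) / 2))) ∧
    (∀ ε : ℝ, 0 < ε → ε < 1 → ∃ c : ℝ, 0 < c ∧ ∀ (m k : ℕ)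
        (Ω : Type*) [MeasurableSpace Ω] (P : Measure Ω) [IsProbabilityMeasure P]
        (x : Ω → Fin m → Bool) (y : Ω → Fin k → Bool),
        EpsMartingale P ε (fun ω => Fin.append (x ω) (y ω)) →
        P.real {ω | HasBalancedFork (x ω) (y ω)} = P.real {ω | 0 ≤ relMargin (x ω) (y ω)} ∧
        P.real {ω | 0 ≤ relMargin (x ω) (y ω)} ≤ Real.exp (-(c * (k : ℝ)))) := by
  -- With C = 3 the bound is at least 1 once ε ≥ 1/3, so only ε ≤ 1/3 needs `marginProb_le_exp`.
  refine ⟨⟨3, by norm_num, ?_⟩, ?_⟩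
  · intro ε h0 h1 m k Ω _ P _ x y Ω' _ P' _ x' y' hW hx hy hxy
    have hP' : P'.real {ω | 0 ≤ relMargin (x' ω) (y' ω)} = bernoulliMean ((1 - ε) / 2) (m + k)
        (Set.indicator {w | ∃ F : Fork w, F.Balanced m} 1) := by
      rw [setOf_relMargin_nonneg]
      exact real_append_preimage P' hx hy hxy _
    refine ⟨hP' ▸ hW.real_relMargin_le P (by linarith) h1.le, ?_⟩
    rcases le_total ε (1 / 3) with hε | hε
    · rw [hP']
      exact (bernoulliMean_balanced_le (by linarith) (by linarith) m k).trans
        (marginProb_le_exp h0 hε m k)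
    · refine measureReal_le_one.trans (Real.one_le_exp ?_)
      have : 0 ≤ ε ^ 3 * (3 * ε - 1) * k :=
        mul_nonneg (mul_nonneg (by positivity) (by linarith)) (Nat.cast_nonneg k)
      linarith
  · intro ε h0 h1
    have hpos : 0 < min ε (1 / 6) := lt_min h0 (by norm_num)
    have hle : min ε (1 / 6) ≤ 1 / 6 := min_le_right _ _
    -- The condition weakens as ε decreases, so ε may be replaced by its minimum with 1/6. Then 1 -
    -- 3ε ≥ 1/2, which leaves the rate ε³/4.
    refine ⟨min ε (1 / 6) ^ 3 / 4, by positivity, fun m k Ω _ P _ x y hW => ⟨?_, ?_⟩⟩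
    · congr 1
      ext ω
      exact hasBalancedFork_iff (x ω) (y ω)
    · refine ((hW.anti P (min_le_left ε (1 / 6))).real_relMargin_le P (by linarith)
        (by linarith)).trans ((bernoulliMean_balanced_le (by linarith) (by linarith) m k).trans
          ((marginProb_le_exp hpos (by linarith) m k).trans (Real.exp_le_exp.2 ?_)))
      have : 0 ≤ min ε (1 / 6) ^ 3 * (1 / 2 - 3 * min ε (1 / 6)) * k :=
        mul_nonneg (mul_nonneg (by positivity) (by linarith)) (Nat.cast_nonneg k)
      linarith
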